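/- For a positive integer $Q$ let $\mathfrak F_Q$ be the Farey sequence of order $Q$, that is, the increasing sequence of reduced fractions in $[0,1]$ with denominator at most $Q$. For integers $r\ge 3$, $\mathfrak d\ge 2$ and $\mathbf c=(c_1,\dots,c_r)$ with $0\le c_1,\dots,c_r\le \mathfrak d-1$, let $N_Q^r(\mathbf c,\mathfrak d)$ be the number of $r$-tuples $(q_1,\dots,q_r)$ of denominators of $r$ consecutive elements of $\mathfrak F_Q$ with $q_j\equiv c_j\pmod{\mathfrak d}$ for $1\le j\le r$, and let $$\rho_Q^r(\mathbf c,\mathfrak d)=\frac{N_Q^r(\mathbf c,\mathfrak d)}{\#\mathfrak F_Q-(r-1)}.$$ Let $\mathcal T=\{(x,y)\in\mathbb R^2: x\le 1,\ y\le 1,\ x+y>1\}$. For $(x,y)\in\mathcal T$ put $L_{-1}=x$, $L_0=y$, $k_j(x,y)=\left[\frac{1+L_{j-2}}{L_{j-1}}\right]$ and $L_j=k_j(x,y)L_{j-1}-L_{j-2}$ for $j\ge1$, where $[\cdot]$ is the integer part. For a vector $\mathbf k=(k_1,\dots,k_s)$ of positive integers let $\mathcal T[\mathbf k]=\{(x,y)\in\mathcal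 T: k_j(x,y)=k_j \text{ for } 1\le j\le s\}$. For $Q\ge1$ and coprime integers $q',q''$ with $q',q''\le Q$ and $q'+q''>Q$, let $(q',q'')$ generate at order $Q$ the sequences given by $q_1=q'$, $q_2=q''$, $k_j=\left[\frac{q_j+Q}{q_{j+1}}\right]$, $q_{j+2}=k_jq_{j+1}-q_j$ for $j\ge1$. Let $\mathcal K^{r-2}(\mathbf c,\mathfrak d)$ be the set of the vectors $(k_1,\dots,k_{r-2})$ that are generated, for some $Q\ge 1$, by some such pair $(q',q'')$ for which also $q_j\equiv c_j\pmod{\mathfrak d}$ for $1\le j\le r$. Theorem. Let $r\ge 3$, $\mathfrak d\ge 2$ and $0\le c_1,\dots,c_r\le\mathfrak d-1$ be integers. Then the series $\sum_{\mathbf k\in\mathcal K^{r-2}(\mathbf c,\mathfrak d)}\mathrm{Area}(\mathcal T[\mathbf k])$ converges and, as $Q\to\infty$, $$\rho_Q^r(\mathbf c,\mathfrak d)=\frac{2}{\mathfrak d^2}\prod_{p\mid\mathfrak d}\Big(1-\frac1{p^2}\Big)^{-1}\sum_{\mathbf k\in\mathcal K^{r-2}(\mathbf c,\mathfrak d)}\mathrm{Area}\big(\mathcal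 T[\mathbf k]\big)+O\big(rQ^{-1}\log^2Q\big),$$ where the product is over the primes dividing $\mathfrak d$ and the implied constant is absolute: there is a constant $C>0$ such that for every $r\ge3$ there is a $Q_0=Q_0(r)$ such that for all $Q\ge Q_0$, all $\mathfrak d\ge2$ and all $\mathbf c$ as above the error term is at most $C\,r\,Q^{-1}\log^2Q$ in absolute value. -/

import Mathlib

namespace FareyResidues

/-- The Farey sequence of order `Q`, as a set: the reduced fractions in `[0, 1]` whose denominators
are at most `Q` (a rational number carries its reduced form). -/
def fareySet (Q : ℕ) : Set ℚ := {f | 0 ≤ f ∧ f ≤ 1 ∧ f.den ≤ Q}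

/-- `f` is an `r`-tuple of consecutive elements of the Farey sequence of order `Q`, in
ascending order. -/
def IsConsecutiveFarey (Q r : ℕ) (f : Fin r → ℚ) : Prop :=
  (∀ i, f i ∈ fareySet Q) ∧ StrictMono f ∧
    ∀ i j : Fin r, (i : ℕ) + 1 = j → ∀ g ∈ fareySet Q, ¬ (f i < g ∧ g < f j)

/-- The `r`-tuples of denominators of consecutive fractions in the Farey sequence of order `Q`. -/
def consecutiveDenominators (Q r : ℕ) : Set (Fin r → ℕ) :=
  {q | ∃ f : Fin r → ℚ, IsConsecutiveFarey Q r f ∧ ∀ i, q i = (f i).den}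

/-- The `r`-tuples of consecutive denominators that are congruent to `c` modulo `d`. -/
def tuplesOfParity (Q r : ℕ) (c : Fin r → ℕ) (d : ℕ) : Set (Fin r → ℕ) :=
  {q | q ∈ consecutiveDenominators Q r ∧ ∀ j, q j ≡ c j [MOD d]}

/-- The proportion of `r`-tuples of consecutive denominators in the Farey sequence of
order `Q` that are congruent to `c` modulo `d`. -/
noncomputable def rho (Q r : ℕ) (c : Fin r → ℕ) (d : ℕ) : ℝ :=
  ((tuplesOfParity Q r c d).ncard : ℝ) / (((fareySet Q).ncard : ℝ) - ((r : ℝ) - 1))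

/-- `(q₁, q₂)` is a lattice point with coprime coordinates in the Farey triangle scaled
by `Q`. -/
def IsGenerator (Q q₁ q₂ : ℤ) : Prop :=
  q₁ ≤ Q ∧ q₂ ≤ Q ∧ Q < q₁ + q₂ ∧ IsCoprime q₁ q₂

/-- The sequence of denominators generated by `(q₁, q₂)` at order `Q` (the first one has
index `0`); the division is the integer part. -/
def genDenom (Q q₁ q₂ : ℤ) : ℕ → ℤ
  | 0 => q₁
  | 1 => q₂
  | j + 2 => ((genDenom Q q₁ q₂ j + Q) / genDenom Q q₁ q₂ (j + 1)) * genDenom Q q₁ q₂ (j + 1)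
      - genDenom Q q₁ q₂ j

/-- The sequence of integers `k` generated by `(q₁, q₂)` at order `Q` (the first one has
index `0`). -/
def genIndex (Q q₁ q₂ : ℤ) (j : ℕ) : ℤ :=
  (genDenom Q q₁ q₂ j + Q) / genDenom Q q₁ q₂ (j + 1)

/-- The admissible vectors with `s` components: those generated by a coprime lattice point of the
scaled Farey triangle of some order `Q ≥ 1`. -/
def admissible (s : ℕ) : Set (Fin s → ℕ) :=
  {k | ∃ Q q₁ q₂ : ℤ, 1 ≤ Q ∧ IsGenerator Q q₁ q₂ ∧ ∀ j : Fin s, genIndex Q q₁ q₂ j = (k j : ℤ)}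

/-- The admissible vectors with `r - 2` components that correspond to `r`-tuples of denominators
congruent to `c` modulo `d`. -/
def admissibleOfParity (r : ℕ) (c : Fin r → ℕ) (d : ℕ) : Set (Fin (r - 2) → ℕ) :=
  {k | k ∈ admissible (r - 2) ∧ ∃ Q q₁ q₂ : ℤ, 1 ≤ Q ∧ IsGenerator Q q₁ q₂ ∧
    (∀ j : Fin (r - 2), genIndex Q q₁ q₂ j = (k j : ℤ)) ∧
    ∀ j : Fin r, genDenom Q q₁ q₂ j ≡ (c j : ℤ) [ZMOD (d : ℤ)]}

/-- The Farey triangle, with vertices `(1, 0)`, `(1, 1)`, `(0, 1)`; the side through `(1, 0)` and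
`(0, 1)` does not belong to it. -/
def fareyTriangle : Set (ℝ × ℝ) := {p | p.1 ≤ 1 ∧ p.2 ≤ 1 ∧ 1 < p.1 + p.2}

/-- The sequence `L` started at `(x, y)`, with its indices shifted by one:
`fareyL x y 0 = x` and `fareyL x y 1 = y`. -/
noncomputable def fareyL (x y : ℝ) : ℕ → ℝ
  | 0 => x
  | 1 => y
  | j + 2 => (⌊(1 + fareyL x y j) / fareyL x y (j + 1)⌋ : ℝ) * fareyL x y (j + 1) - fareyL x y j

/-- The integer parts that occur in the recursion for `fareyL` (the first one has index `0`). -/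
noncomputable def fareyIndex (x y : ℝ) (j : ℕ) : ℤ :=
  ⌊(1 + fareyL x y j) / fareyL x y (j + 1)⌋

/-- The polygon `T[k]`: the points of the Farey triangle whose vector of indices is `k`. -/
def polygon {s : ℕ} (k : Fin s → ℕ) : Set (ℝ × ℝ) :=
  {p | p ∈ fareyTriangle ∧ ∀ j : Fin s, fareyIndex p.1 p.2 j = (k j : ℤ)}

/-- The area of a plane set. -/
noncomputable def area (S : Set (ℝ × ℝ)) : ℝ := (MeasureTheory.volume S).toReal

/-- The main term
`(2 / d ^ 2) ∏_{p ∣ d} (1 - p ^ (-2))⁻¹ ∑_k Area (T[k])`, with `k` running over the admissible vectors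
that correspond to `c` modulo `d`. -/
noncomputable def mainTerm (r : ℕ) (c : Fin r → ℕ) (d : ℕ) : ℝ :=
  2 / (d : ℝ) ^ 2 * (∏ p ∈ d.primeFactors, (1 - 1 / (p : ℝ) ^ 2)⁻¹) *
    ∑' k : admissibleOfParity r c d, area (polygon (k : Fin (r - 2) → ℕ))

end FareyResidues

namespace FareyResidues

open MeasureTheory Set

/-! Pairs of neighbouring denominators at order `Q` are exactly the coprime lattice points of the
Farey triangle scaled by `Q`, and such a pair generates all later denominators. The index vector `k`
of a pair records the polygon `T[k]` containing the scaled point. Once `k` is fixed the recursion is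
linear with fixed integer coefficients, so `k` and the first two residues determine all `r` residues
(`genDenom_modEq`). Up to at most `r` tuples lost at the end of the sequence, the count is therefore
the sum, over the admissible `k`, of the number of coprime points of `Q · T[k]` in one fixed residue
class modulo `d`.

Each `T[k]` is convex, so Möbius inversion gives the expected number of points with an error `O(Q
log Q)` (`abs_ncard_coprime_sub_area_le`). Infinitely many `k` occur, so this alone cannot be
summed. With `s = r - 2`, the vectors are split at the threshold `4 * s + 13`. Those with all
components below it number at most `(4 * s + 13) ^ s`, which is at most `log Q` once `Q` is large in
terms of `r`; they contribute `O(Q log² Q)`. If a component `k` in position `j` reaches the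
threshold, the vector must be `(2, …, 2, 1, k, 1, 2, …, 2)` (`eq_peakVector`), and its polygon is a
unimodular image of the polygon with first index `k` (`polygon_peakVector`). That polygon is a thin
piece at height about `2 / k`, with an error bound summable over `k` to `O(Q log² Q)`
(`sum_peakError_le`); the `s` positions produce the factor `r`.

Dividing by the size of the Farey sequence, which is `(3 / π²) Q² + O(Q log Q)`, gives the theorem.
Summability of the areas is immediate, since the polygons are disjoint parts of the triangle. -/

/-! ### Lattice points of plane convex sets in a residue class -/

theorem finite_int_of_bounded {I : Set ℝ} (hb : Bornology.IsBounded I) :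
    {a : ℤ | (a : ℝ) ∈ I}.Finite := by
  obtain ⟨r, hr⟩ := hb.subset_closedBall 0
  rw [Real.closedBall_eq_Icc] at hr
  have : {a : ℤ | (a : ℝ) ∈ I} ⊆ ((↑) : ℤ → ℝ) ⁻¹' Icc (0 - r) (0 + r) := fun a ha => hr ha
  rw [Int.preimage_Icc] at this
  exact (Set.finite_Icc _ _).subset this

theorem abs_ncard_int_sub_volume_le {I : Set ℝ} (hI : I.OrdConnected)
    (hb : Bornology.IsBounded I) :
    |({a : ℤ | (a : ℝ) ∈ I}.ncard : ℝ) - volume.real I| ≤ 1 := by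
  rcases I.eq_empty_or_nonempty with rfl | hne
  · simp
  set α := sInf I
  set β := sSup I
  have hbb := hb.bddBelow
  have hba := hb.bddAbove
  have h1 : I ⊆ Icc α β := fun x hx => ⟨csInf_le hbb hx, le_csSup hba hx⟩
  have h2 : Ioo α β ⊆ I := by
    intro x hx
    obtain ⟨a, ha, hax⟩ := exists_lt_of_csInf_lt hne hx.1
    obtain ⟨b, hb', hxb⟩ := exists_lt_of_lt_csSup hne hx.2
    exact hI.out ha hb' ⟨hax.le, hxb.le⟩
  have hαβ : α ≤ β := by
    obtain ⟨x, hx⟩ := hne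
    exact (h1 hx).1.trans (h1 hx).2
  have hv : volume.real I = β - α := by
    apply le_antisymm
    · have := measureReal_mono (μ := volume) h1 (by simp)
      rwa [Real.volume_real_Icc_of_le hαβ] at this
    · have := measureReal_mono (μ := volume) h2 (hb.measure_lt_top.ne)
      rwa [Real.volume_real_Ioo_of_le hαβ] at this
  have hfin := finite_int_of_bounded hb
  have hu : ({a : ℤ | (a : ℝ) ∈ I}.ncard : ℝ) ≤ β - α + 1 := by
    have hs : {a : ℤ | (a : ℝ) ∈ I} ⊆ (Finset.Icc ⌈α⌉ ⌊β⌋ : Finset ℤ) := by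
      intro a ha
      have := h1 ha
      simp only [Finset.coe_Icc, mem_Icc]
      exact ⟨Int.ceil_le.2 this.1, Int.le_floor.2 this.2⟩
    have h3 := Set.ncard_le_ncard hs (Finset.finite_toSet _)
    rw [Set.ncard_coe_finset, Int.card_Icc] at h3
    have h4 : (({a : ℤ | (a : ℝ) ∈ I}.ncard : ℤ)) ≤ max (⌊β⌋ + 1 - ⌈α⌉) 0 := by
      rw [← Int.toNat_eq_max]; exact_mod_cast h3
    have h5 : (({a : ℤ | (a : ℝ) ∈ I}.ncard : ℝ)) ≤ max (⌊β⌋ + 1 - ⌈α⌉ : ℝ) 0 := by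
      exact_mod_cast h4
    refine h5.trans (max_le ?_ (by linarith))
    linarith [Int.floor_le β, Int.le_ceil α]
  have hl : β - α - 1 ≤ ({a : ℤ | (a : ℝ) ∈ I}.ncard : ℝ) := by
    have hs : ((Finset.Ioo ⌊α⌋ ⌈β⌉ : Finset ℤ) : Set ℤ) ⊆ {a : ℤ | (a : ℝ) ∈ I} := by
      intro a ha
      simp only [Finset.coe_Ioo, mem_Ioo] at ha
      exact h2 ⟨Int.floor_lt.1 ha.1, Int.lt_ceil.1 ha.2⟩
    have h3 := Set.ncard_le_ncard hs hfin
    rw [Set.ncard_coe_finset, Int.card_Ioo] at h3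
    have h4 : ⌈β⌉ - ⌊α⌋ - 1 ≤ ({a : ℤ | (a : ℝ) ∈ I}.ncard : ℤ) :=
      (Int.self_le_toNat _).trans (by exact_mod_cast h3)
    have h5 : (⌈β⌉ - ⌊α⌋ - 1 : ℝ) ≤ ({a : ℤ | (a : ℝ) ∈ I}.ncard : ℝ) := by exact_mod_cast h4
    linarith [Int.floor_le α, Int.le_ceil β]
  rw [hv, abs_le]
  constructor <;> linarith

/-- The number of integers of a residue class in an interval. -/
theorem abs_ncard_modEq_sub_volume_le {I : Set ℝ} (hI : I.OrdConnected)
    (hb : Bornology.IsBounded I) {h : ℕ} (hh : 0 < h) (c : ℤ) :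
    |({a : ℤ | a ≡ c [ZMOD h] ∧ (a : ℝ) ∈ I}.ncard : ℝ) - volume.real I / h| ≤ 1 := by
  have hh' : (0 : ℝ) < h := by exact_mod_cast hh
  set J : Set ℝ := (fun t : ℝ => h * t + c) ⁻¹' I with hJ
  have hJo : J.OrdConnected := by
    refine ⟨fun x hx y hy z hz => hI.out hx hy ⟨?_, ?_⟩⟩
    · have := mul_le_mul_of_nonneg_left hz.1 hh'.le; simp only; linarith
    · have := mul_le_mul_of_nonneg_left hz.2 hh'.le; simp only; linarith
  have hJI : J = (fun t : ℝ => h * t) ⁻¹' ((fun t : ℝ => t + c) ⁻¹' I) := rfl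
  have hJb : Bornology.IsBounded J := by
    obtain ⟨r, hr⟩ := hb.subset_closedBall 0
    rw [Real.closedBall_eq_Icc] at hr
    refine (Metric.isBounded_Icc ((-r - c) / h) ((r - c) / h)).subset fun x hx => ?_
    have := hr hx
    simp only [mem_Icc] at this ⊢
    rw [div_le_iff₀ hh', le_div_iff₀ hh']
    constructor <;> linarith [this.1, this.2]
  have hvol : volume.real J = volume.real I / h := by
    rw [hJI, measureReal_def, Real.volume_preimage_mul_left hh'.ne', measure_preimage_add_right,
      ENNReal.toReal_mul, ENNReal.toReal_ofReal (abs_nonneg _), abs_of_pos (inv_pos.2 hh'),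
      measureReal_def]
    ring
  have hcard : {a : ℤ | a ≡ c [ZMOD h] ∧ (a : ℝ) ∈ I}.ncard = {a : ℤ | (a : ℝ) ∈ J}.ncard := by
    rw [← Set.ncard_image_of_injective {a : ℤ | (a : ℝ) ∈ J}
      (f := fun t : ℤ => (h : ℤ) * t + c)
      (fun a b hab => by
        have : (h : ℤ) ≠ 0 := by exact_mod_cast hh.ne'
        exact mul_left_cancel₀ this (add_right_cancel hab))]
    congr 1
    ext a
    simp only [mem_ofPred_eq, mem_image, hJ, mem_preimage]
    constructor
    · rintro ⟨h1, h2⟩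
      obtain ⟨t, ht⟩ := (Int.modEq_iff_dvd.1 h1.symm)
      refine ⟨t, ?_, by linarith⟩
      have : (a : ℝ) = h * t + c := by
        have : a = h * t + c := by linarith
        rw [this]; push_cast; ring
      rwa [← this]
    · rintro ⟨t, h1, rfl⟩
      refine ⟨?_, by push_cast; exact h1⟩
      exact (Int.modEq_iff_dvd.2 ⟨t, by ring⟩).symm
  rw [hcard, ← hvol]
  exact abs_ncard_int_sub_volume_le hJo hJb

/-- Summation of a quasiconcave function over a residue class. -/
theorem abs_sum_quasiconcave_sub_integral_le {g : ℝ → ℝ} (hg : Measurable g) {W H : ℝ}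
    (g_nonneg : ∀ y, 0 ≤ g y) (g_le : ∀ y, g y ≤ W)
    (g_supp : ∀ y, g y ≠ 0 → y ∈ Icc 0 H)
    (g_conn : ∀ t, 0 < t → {y | t ≤ g y}.OrdConnected)
    {h : ℕ} (hh : 0 < h) (c : ℤ) (B : Finset ℤ)
    (hB : ∀ b ∈ B, b ≡ c [ZMOD h]) (hB' : ∀ b : ℤ, b ≡ c [ZMOD h] → g b ≠ 0 → b ∈ B) :
    |∑ b ∈ B, g b - (∫ y, g y) / h| ≤ W := by
  have hh' : (0 : ℝ) < h := by exact_mod_cast hh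
  have hW : 0 ≤ W := (g_nonneg 0).trans (g_le 0)
  have hsupp : ∀ t, 0 < t → {y | t ≤ g y} ⊆ Icc 0 H := fun t ht y hy =>
    g_supp y (ht.trans_le hy).ne'
  have hint : Integrable g := by
    have : IntegrableOn g (Icc 0 H) := by
      refine Measure.integrableOn_of_bounded (M := W) (by simp) hg.aestronglyMeasurable ?_
      refine Filter.Eventually.of_forall fun y => ?_
      rw [Real.norm_of_nonneg (g_nonneg y)]; exact g_le y
    refine (integrableOn_iff_integrable_of_support_subset ?_).1 this
    exact fun y hy => g_supp y hy
  -- Layer-cake formula: the sum and the integral both become integrals over the height `t ∈ (0, W]`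
  -- of the level sets `{t ≤ g}`. These are intervals, on each of which counting is off by at most
  -- `1`, so the total error is at most `W`.
  have h1 : ∫ y, g y = ∫ t in Ioc 0 W, volume.real {y | t ≤ g y} :=
    hint.integral_eq_integral_Ioc_meas_le (Filter.Eventually.of_forall g_nonneg)
      (Filter.Eventually.of_forall g_le)
  have hmeas : Measurable fun t : ℝ => volume.real {y | t ≤ g y} := by
    have hs : MeasurableSet {p : ℝ × ℝ | p.1 ≤ g p.2} :=
      measurableSet_le measurable_fst (hg.comp measurable_snd)
    exact (measurable_measure_prodMk_left (ν := (volume : Measure ℝ)) hs).ennreal_toReal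
  have hint2 : IntegrableOn (fun t : ℝ => volume.real {y | t ≤ g y}) (Ioc 0 W) := by
    refine Measure.integrableOn_of_bounded (M := volume.real (Icc 0 H)) (by simp)
      hmeas.aestronglyMeasurable ?_
    filter_upwards [ae_restrict_mem measurableSet_Ioc] with t ht
    rw [Real.norm_of_nonneg measureReal_nonneg]
    exact measureReal_mono (hsupp t ht.1) (by simp)
  have hone : ∀ b : ℤ, ∫ t in Ioc 0 W, (if t ≤ g b then (1 : ℝ) else 0) = g b := by
    intro b
    have : (fun t : ℝ => if t ≤ g b then (1 : ℝ) else 0) = (Iic (g b)).indicator 1 := by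
      ext t; simp [indicator_apply]
    rw [this, setIntegral_indicator measurableSet_Iic, Ioc_inter_Iic, min_eq_right (g_le b)]
    simp [g_nonneg b]
  have hone_int : ∀ b : ℤ, IntegrableOn (fun t : ℝ => if t ≤ g b then (1 : ℝ) else 0) (Ioc 0 W) := by
    intro b
    refine Measure.integrableOn_of_bounded (M := 1) (by simp)
      (Measurable.ite measurableSet_Iic measurable_const measurable_const).aestronglyMeasurable ?_
    refine Filter.Eventually.of_forall fun t => ?_
    split_ifs <;> simp
  have h2 : ∑ b ∈ B, g b = ∫ t in Ioc 0 W, ∑ b ∈ B, (if t ≤ g b then (1 : ℝ) else 0) := by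
    rw [integral_finsetSum _ fun b _ => hone_int b]
    simp_rw [hone]
  have h3 : ∑ b ∈ B, g b - (∫ y, g y) / h =
      ∫ t in Ioc 0 W, ((∑ b ∈ B, (if t ≤ g b then (1 : ℝ) else 0)) -
        volume.real {y | t ≤ g y} / h) := by
    rw [integral_sub (integrable_finsetSum _ fun b _ => hone_int b) (hint2.div_const _), ← h2,
      integral_div, ← h1]
  rw [h3, ← Real.norm_eq_abs]
  refine (norm_setIntegral_le_of_norm_le_const (C := 1) (by simp) ?_).trans ?_
  · intro t ht
    have hbd : Bornology.IsBounded {y | t ≤ g y} := (Metric.isBounded_Icc 0 H).subset (hsupp t ht.1)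
    have hc : ∑ b ∈ B, (if t ≤ g b then (1 : ℝ) else 0) =
        ({b : ℤ | b ≡ c [ZMOD h] ∧ (b : ℝ) ∈ {y | t ≤ g y}}.ncard : ℝ) := by
      rw [Finset.sum_boole, ← Set.ncard_coe_finset]
      congr 2
      ext b
      simp only [Finset.coe_filter, mem_ofPred_eq]
      constructor
      · rintro ⟨h1, h2⟩; exact ⟨hB b h1, h2⟩
      · rintro ⟨h1, h2⟩; exact ⟨hB' b h1 (ht.1.trans_le h2).ne', h2⟩
    rw [hc, Real.norm_eq_abs]
    exact abs_ncard_modEq_sub_volume_le (g_conn t ht.1) hbd hh c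
  · simp [hW]

theorem volume_real_le_of_forall_sub_le {S : Set ℝ} {D : ℝ} (hD : 0 ≤ D)
    (h : ∀ x ∈ S, ∀ x' ∈ S, x' - x ≤ D) : volume.real S ≤ D := by
  have h1 : volume S ≤ ENNReal.ofReal D := by
    refine (Real.volume_le_diam S).trans (Metric.ediam_le fun x hx y hy => ?_)
    rw [edist_dist]
    refine ENNReal.ofReal_le_ofReal ?_
    rw [Real.dist_eq, abs_le]
    constructor <;> linarith [h x hx y hy, h y hy x hx]
  exact ENNReal.toReal_le_of_le_ofReal hD h1

/-- The horizontal sections of a plane convex set of bounded width. -/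
theorem ordConnected_le_volume_section {R : Set (ℝ × ℝ)} (hc : Convex ℝ R) {W : ℝ}
    (hW : ∀ x x' y, (x, y) ∈ R → (x', y) ∈ R → x' - x ≤ W) {t : ℝ} :
    {y | t ≤ volume.real {x | (x, y) ∈ R}}.OrdConnected := by
  -- Sections need not contain their endpoints, so a section of length at least `t` only supplies
  -- pairs of points more than `e` apart for each `e < t`. Convexity carries such pairs to
  -- intermediate heights.
  have key : ∀ y, t ≤ volume.real {x | (x, y) ∈ R} → ∀ e, 0 ≤ e → e < t →
      ∃ a b, (a, y) ∈ R ∧ (b, y) ∈ R ∧ e < b - a := by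
    intro y hy e he het
    by_contra! hcon
    have := volume_real_le_of_forall_sub_le (S := {x | (x, y) ∈ R}) he
      fun x hx x' hx' => hcon x x' hx hx'
    linarith
  refine ⟨fun y₁ h₁ y₂ h₂ y hy => ?_⟩
  rw [mem_ofPred_eq]
  refine le_of_forall_lt fun e' he' => ?_
  rcases lt_or_ge e' 0 with h0 | h0
  · exact h0.trans_le measureReal_nonneg
  obtain ⟨e, he1, he2⟩ := exists_between he'
  obtain ⟨a₁, b₁, ha₁, hb₁, hd₁⟩ := key y₁ h₁ e (h0.trans he1.le) he2
  obtain ⟨a₂, b₂, ha₂, hb₂, hd₂⟩ := key y₂ h₂ e (h0.trans he1.le) he2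
  have hseg : y ∈ segment ℝ y₁ y₂ := by
    rw [segment_eq_Icc (hy.1.trans hy.2)]; exact hy
  obtain ⟨u, v, hu, hv, huv, rfl⟩ := hseg
  have hA : (u * a₁ + v * a₂, u • y₁ + v • y₂) ∈ R := by
    simpa using hc ha₁ ha₂ hu hv huv
  have hB : (u * b₁ + v * b₂, u • y₁ + v • y₂) ∈ R := by
    simpa using hc hb₁ hb₂ hu hv huv
  set y := u • y₁ + v • y₂
  have hlen : e ≤ (u * b₁ + v * b₂) - (u * a₁ + v * a₂) := by
    have : e = u * e + v * e := by rw [← add_mul, huv, one_mul]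
    nlinarith
  have hsub : Icc (u * a₁ + v * a₂) (u * b₁ + v * b₂) ⊆ {x | (x, y) ∈ R} := by
    intro x hx
    have hx' : x ∈ segment ℝ (u * a₁ + v * a₂) (u * b₁ + v * b₂) := by
      rw [segment_eq_Icc (hx.1.trans hx.2)]; exact hx
    obtain ⟨u', v', hu', hv', huv', rfl⟩ := hx'
    have := hc hA hB hu' hv' huv'
    rw [Prod.smul_mk, Prod.smul_mk, Prod.mk_add_mk, Convex.combo_self huv'] at this
    exact this
  have hfin : volume {x | (x, y) ∈ R} ≠ ⊤ := by
    refine ne_top_of_le_ne_top (b := volume (Icc (u * a₁ + v * a₂ - W) (u * a₁ + v * a₂ + W)))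
      (by simp) (measure_mono fun x hx => ?_)
    exact ⟨by linarith [hW _ _ _ hx hA], by linarith [hW _ _ _ hA hx]⟩
  have := measureReal_mono (μ := volume) hsub hfin
  rw [Real.volume_real_Icc_of_le (by linarith)] at this
  linarith

/-- The lattice points of a plane convex set in a residue class. -/
theorem abs_ncard_lattice_sub_area_le {R : Set (ℝ × ℝ)} (hc : Convex ℝ R) (hm : MeasurableSet R)
    {W H : ℝ} (hW0 : 0 ≤ W) (hW : ∀ x x' y, (x, y) ∈ R → (x', y) ∈ R → x' - x ≤ W)
    (hH : ∀ p ∈ R, p.2 ∈ Icc 0 H) {h : ℕ} (hh : 0 < h) (c₁ c₂ : ℤ) (B : Finset ℤ)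
    (hB : ∀ b ∈ B, b ≡ c₂ [ZMOD h])
    (hB' : ∀ b : ℤ, b ≡ c₂ [ZMOD h] → ∀ x, (x, (b : ℝ)) ∈ R → b ∈ B) :
    |({p : ℤ × ℤ | p.1 ≡ c₁ [ZMOD h] ∧ p.2 ≡ c₂ [ZMOD h] ∧
        ((p.1 : ℝ), (p.2 : ℝ)) ∈ R}.ncard : ℝ) - area R / (h : ℝ) ^ 2| ≤ B.card + W / h := by
  have hh' : (0 : ℝ) < h := by exact_mod_cast hh
  set g : ℝ → ℝ := fun y => volume.real {x | (x, y) ∈ R} with hg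
  have hgm : Measurable g :=
    (measurable_measure_prodMk_right (μ := (volume : Measure ℝ)) hm).ennreal_toReal
  have hgle : ∀ y, g y ≤ W := fun y =>
    volume_real_le_of_forall_sub_le hW0 fun x hx x' hx' => hW x x' y hx hx'
  have hgne : ∀ y, g y ≠ 0 → ∃ x, (x, y) ∈ R := by
    intro y hy
    by_contra! hcon
    apply hy
    have : {x | (x, y) ∈ R} = ∅ := by ext x; simp [hcon x]
    simp [hg, this]
  have hbdd : ∀ y, Bornology.IsBounded {x | (x, y) ∈ R} := by
    intro y
    rcases Set.eq_empty_or_nonempty {x | (x, y) ∈ R} with h | ⟨a, ha⟩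
    · rw [h]; exact Bornology.isBounded_empty
    · exact (Metric.isBounded_Icc (a - W) (a + W)).subset fun x hx =>
        ⟨by linarith [hW _ _ _ hx ha], by linarith [hW _ _ _ ha hx]⟩
  have hsec : ∀ y, {x | (x, y) ∈ R}.OrdConnected := by
    intro y
    apply Convex.ordConnected
    intro a ha b hb u v hu hv huv
    have := hc ha hb hu hv huv
    rw [Prod.smul_mk, Prod.smul_mk, Prod.mk_add_mk, Convex.combo_self huv] at this
    exact this
  have harea : area R = ∫ y, g y := by
    rw [area, Measure.volume_eq_prod, Measure.prod_apply_symm hm, hg]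
    simp only [measureReal_def]
    rw [integral_toReal]
    · rfl
    · exact (measurable_measure_prodMk_right hm).aemeasurable
    · exact Filter.Eventually.of_forall fun y => (hbdd y).measure_lt_top
  have hsum := abs_sum_quasiconcave_sub_integral_le hgm (fun y => measureReal_nonneg) hgle
    (fun y hy => by obtain ⟨x, hx⟩ := hgne y hy; exact hH _ hx)
    (fun _ _ => ordConnected_le_volume_section hc hW) hh c₂ B hB
    (fun b hb hgb => by obtain ⟨x, hx⟩ := hgne b hgb; exact hB' b hb x hx)
  set S : Set (ℤ × ℤ) := {p : ℤ × ℤ | p.1 ≡ c₁ [ZMOD h] ∧ p.2 ≡ c₂ [ZMOD h] ∧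
        ((p.1 : ℝ), (p.2 : ℝ)) ∈ R} with hS
  have hcount : S.ncard = ∑ b ∈ B,
      {a : ℤ | a ≡ c₁ [ZMOD h] ∧ (a : ℝ) ∈ {x | (x, (b : ℝ)) ∈ R}}.ncard := by
    have hfib : ∀ b : ℤ, {a : ℤ | a ≡ c₁ [ZMOD h] ∧ (a : ℝ) ∈ {x | (x, (b : ℝ)) ∈ R}}.Finite :=
      fun b => (finite_int_of_bounded (hbdd b)).subset fun a ha => ha.2
    have : S = ↑(B.biUnion fun b => (hfib b).toFinset.image fun a => (a, b)) := by
      ext ⟨a, b⟩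
      simp only [hS, mem_ofPred_eq, Finset.coe_biUnion, Finset.coe_image, Finite.coe_toFinset,
        mem_iUnion, mem_image, Prod.mk.injEq, SetLike.mem_coe]
      constructor
      · rintro ⟨h1, h2, h3⟩
        exact ⟨b, hB' b h2 _ h3, a, ⟨h1, h3⟩, rfl, rfl⟩
      · rintro ⟨b, hb, a, ⟨h1, h3⟩, rfl, rfl⟩
        exact ⟨h1, hB b hb, h3⟩
    rw [this, Set.ncard_coe_finset, Finset.card_biUnion]
    · refine Finset.sum_congr rfl fun b _ => ?_
      rw [Finset.card_image_of_injective _ (fun a a' haa => by simpa using haa),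
        ← Set.ncard_eq_toFinset_card _ (hfib b)]
    · intro b _ b' _ hbb
      rw [Function.onFun, Finset.disjoint_left]
      intro p hp hp'
      simp only [Finset.mem_image] at hp hp'
      obtain ⟨_, _, rfl⟩ := hp
      obtain ⟨_, _, h⟩ := hp'
      exact hbb (Prod.mk.inj h).2.symm
  rw [hcount, harea]
  push_cast
  -- Two sources of error: at most `1` for each row in `B`, and the replacement of the sum of the
  -- row lengths by the area, which costs `W / h` because the row length is quasiconcave in the
  -- height.
  have h1 : |∑ b ∈ B, (({a : ℤ | a ≡ c₁ [ZMOD h] ∧ (a : ℝ) ∈ {x | (x, (b : ℝ)) ∈ R}}.ncard : ℝ) -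
      g b / h)| ≤ B.card := by
    refine (Finset.abs_sum_le_sum_abs _ _).trans ?_
    have hcard : (B.card : ℝ) = ∑ b ∈ B, (1 : ℝ) := by simp
    rw [hcard]
    exact Finset.sum_le_sum fun b _ => abs_ncard_modEq_sub_volume_le (hsec b) (hbdd b) hh c₁
  rw [Finset.sum_sub_distrib, ← Finset.sum_div] at h1
  have h2 : |(∑ b ∈ B, g b) / h - (∫ y, g y) / (h : ℝ) ^ 2| ≤ W / h := by
    have : (∑ b ∈ B, g b) / h - (∫ y, g y) / (h : ℝ) ^ 2 =
      (∑ b ∈ B, g b - (∫ y, g y) / h) / h := by field_simp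
    rw [this, abs_div, abs_of_pos hh']
    gcongr
  rw [abs_le] at *
  constructor <;> linarith [h1.1, h1.2, h2.1, h2.2]

/-! ### Möbius inversion and coprime lattice points -/

-- The Dirichlet series of `χ μ`, with `χ` the trivial character modulo `d`, is the inverse of `ζ(s)
-- ∏ (1 - p ^ (-s))` over `p ∣ d`; here `s = 2` and `ζ(2) = π² / 6`.
open ArithmeticFunction in
theorem hasSum_moebius_coprime {d : ℕ} (hd : d ≠ 0) :
    HasSum (fun m : ℕ => if m.Coprime d then (moebius m : ℝ) / (m : ℝ) ^ 2 else 0)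
      (6 / Real.pi ^ 2 * (∏ p ∈ d.primeFactors, (1 - 1 / (p : ℝ) ^ 2)⁻¹)) := by
  have : NeZero d := ⟨hd⟩
  set χ : DirichletCharacter ℂ d := 1
  have h2 : (1 : ℝ) < (2 : ℂ).re := by norm_num
  have h1 := DirichletCharacter.LSeries.mul_mu_eq_one χ h2
  rw [← DirichletCharacter.LFunction_eq_LSeries χ h2] at h1
  have h3 := DirichletCharacter.LFunctionTrivChar_eq_mul_riemannZeta (N := d) (s := 2) (by norm_num)
  rw [DirichletCharacter.LFunctionTrivChar] at h3
  rw [h3, riemannZeta_two] at h1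
  have hsum := DirichletCharacter.LSeriesSummable_mul χ
    (ArithmeticFunction.LSeriesSummable_moebius_iff.mpr h2)
  have h4 := hsum.hasSum
  change HasSum _ (LSeries _ 2) at h4
  rw [eq_inv_of_mul_eq_one_right h1] at h4
  rw [← Complex.hasSum_ofReal]
  convert! h4 using 1
  · ext m
    rw [LSeries.term_def]
    rcases eq_or_ne m 0 with rfl | hm
    · simp
    · rw [if_neg hm]
      have : (χ m : ℂ) = if m.Coprime d then 1 else 0 := by
        split_ifs with h
        · exact MulChar.one_apply ((ZMod.isUnit_iff_coprime m d).2 h)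
        · exact MulChar.map_nonunit _ (fun h' => h ((ZMod.isUnit_iff_coprime m d).1 h'))
      simp only [Pi.mul_apply, this]
      split_ifs <;> simp
  · push_cast
    rw [mul_inv, mul_comm, ← Finset.prod_inv_distrib]
    congr 1
    · refine Finset.prod_congr rfl fun p _ => ?_
      rw [Complex.cpow_neg]; simp
    · rw [inv_div]

open ArithmeticFunction in
theorem abs_sum_moebius_coprime_sub_le {d : ℕ} (hd : d ≠ 0) (M : ℕ) :
    |∑ m ∈ Finset.Icc 1 M, (if m.Coprime d then (moebius m : ℝ) / (m : ℝ) ^ 2 else 0) -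
      6 / Real.pi ^ 2 * (∏ p ∈ d.primeFactors, (1 - 1 / (p : ℝ) ^ 2)⁻¹)| ≤ (2 : ℝ) / ((M : ℝ) + 1) := by
  set f : ℕ → ℝ := fun m : ℕ => if m.Coprime d then (moebius m : ℝ) / (m : ℝ) ^ 2 else 0 with hf
  have hfle : ∀ m, |f m| ≤ ((m : ℝ) ^ 2)⁻¹ := by
    intro m
    simp only [hf]
    split_ifs
    · rw [abs_div, abs_of_nonneg (sq_nonneg (m : ℝ)), div_eq_mul_inv]
      refine mul_le_of_le_one_left (by positivity) ?_
      exact_mod_cast abs_moebius_le_one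
    · simp
  have hlim := ((hasSum_moebius_coprime hd).tendsto_sum_nat.const_sub
    (∑ m ∈ Finset.Icc 1 M, f m)).abs
  refine le_of_tendsto (f := fun n => |∑ m ∈ Finset.Icc 1 M, f m - ∑ m ∈ Finset.range n, f m|)
    hlim ?_
  filter_upwards [Filter.eventually_ge_atTop (M + 1)] with n hn
  have h1 : ∑ m ∈ Finset.range n, f m = ∑ m ∈ Finset.Icc 1 M, f m + ∑ m ∈ Finset.Ioo M n, f m := by
    have h0 : f 0 = 0 := by simp [hf]
    obtain ⟨k, rfl⟩ : ∃ k, n = k + 1 := ⟨n - 1, by omega⟩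
    rw [Finset.sum_range_succ', h0, add_zero, ← Finset.sum_union]
    · rw [Finset.range_eq_Ico, Finset.sum_Ico_add' f 0 k 1]
      refine Finset.sum_congr ?_ fun _ _ => rfl
      ext m; simp only [Finset.mem_Ico, Finset.mem_union, Finset.mem_Icc, Finset.mem_Ioo]; omega
    · rw [Finset.disjoint_left]; intro m; simp only [Finset.mem_Icc, Finset.mem_Ioo]; omega
  change |_ - ∑ m ∈ Finset.range n, f m| ≤ _
  rw [h1, sub_add_cancel_left, abs_neg]
  exact (Finset.abs_sum_le_sum_abs _ _).trans
    ((Finset.sum_le_sum fun m _ => hfle m).trans (sum_Ioo_inv_sq_le M n))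

/-- The density of the coprime lattice points in an admissible residue class modulo `d`. -/
noncomputable def coprimeDensity (d : ℕ) : ℝ :=
  6 / Real.pi ^ 2 * (∏ p ∈ d.primeFactors, (1 - 1 / (p : ℝ) ^ 2)⁻¹) / (d : ℝ) ^ 2

theorem sum_Icc_inv_le_one_add_log {M : ℕ} {H : ℝ} (hM : (M : ℝ) ≤ H) (hH : 0 ≤ H) :
    ∑ m ∈ Finset.Icc 1 M, ((m : ℝ))⁻¹ ≤ 1 + Real.log (1 + H) := by
  rcases Nat.eq_zero_or_pos M with rfl | hpos
  · simpa using add_nonneg zero_le_one (Real.log_nonneg (by linarith : 1 ≤ 1 + H))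
  · have h1 := harmonic_le_one_add_log M
    rw [harmonic_eq_sum_Icc] at h1
    push_cast at h1
    have h2 : Real.log M ≤ Real.log (1 + H) :=
      Real.log_le_log (by exact_mod_cast hpos) (by linarith)
    linarith

theorem sum_moebius_divisors_eq (n : ℕ) :
    ∑ m ∈ n.divisors, ArithmeticFunction.moebius m = if n = 1 then 1 else 0 := by
  rw [← ArithmeticFunction.coe_mul_zeta_apply, ArithmeticFunction.moebius_mul_coe_zeta,
    ArithmeticFunction.one_apply]

/-- Chinese remainder theorem: for `m` coprime to `d`, the multiples of `m` in a class modulo `d`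
form a single class modulo `m * d`, to which the lattice point count applies. -/
theorem exists_modEq_mul_iff {m d : ℕ} (h : m.Coprime d) (c : ℤ) :
    ∃ c' : ℤ, ∀ a : ℤ, a ≡ c' [ZMOD ((m * d : ℕ) : ℤ)] ↔ ((m : ℤ) ∣ a ∧ a ≡ c [ZMOD d]) := by
  obtain ⟨u, v, huv⟩ := (Nat.isCoprime_iff_coprime.2 h)
  refine ⟨u * m * c, fun a => ?_⟩
  have h1 : u * m * c ≡ c [ZMOD d] := by
    refine Int.modEq_iff_dvd.2 ⟨v * c, ?_⟩
    linear_combination (-c) * huv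
  have h2 : u * m * c ≡ 0 [ZMOD m] := Int.modEq_zero_iff_dvd.2 ⟨u * c, by ring⟩
  push_cast
  rw [← Int.modEq_and_modEq_iff_modEq_mul (by simpa using h), ← Int.modEq_zero_iff_dvd]
  exact ⟨fun ⟨p, q⟩ => ⟨p.trans h2, q.trans h1⟩, fun ⟨p, q⟩ => ⟨p.trans h2.symm, q.trans h1.symm⟩⟩

/-- Every common divisor divides `b ≤ M`, so the cutoff `M` loses no term of the Möbius sum over the
divisors of the gcd. -/
theorem ite_isCoprime_eq_sum {a b : ℤ} {M : ℕ} (hb : 0 < b) (hM : b ≤ M) :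
    (if IsCoprime a b then (1 : ℤ) else 0) =
      ∑ m ∈ Finset.Icc 1 M, if (m : ℤ) ∣ a ∧ (m : ℤ) ∣ b then ArithmeticFunction.moebius m else 0 := by
  rw [← Finset.sum_filter]
  have : (Finset.Icc 1 M).filter (fun m : ℕ => (m : ℤ) ∣ a ∧ (m : ℤ) ∣ b) =
      (Int.gcd a b).divisors := by
    ext m
    have hg : Int.gcd a b ≠ 0 := by
      rw [Ne, Int.gcd_eq_zero_iff]; omega
    rw [Finset.mem_filter, Nat.mem_divisors, Finset.mem_Icc, Int.dvd_gcd_iff]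
    constructor
    · rintro ⟨_, h⟩; exact ⟨h, hg⟩
    · rintro ⟨h, _⟩
      refine ⟨⟨?_, ?_⟩, h⟩
      · rcases Nat.eq_zero_or_pos m with rfl | h0
        · have := h.2; simp at this; omega
        · exact h0
      · have := Int.le_of_dvd hb h.2; omega
  rw [this, sum_moebius_divisors_eq]
  simp only [Int.isCoprime_iff_gcd_eq_one]

open ArithmeticFunction in
/-- The coprime lattice points of a plane convex set in a residue class. -/
theorem abs_ncard_coprime_sub_area_le {R : Set (ℝ × ℝ)} (hc : Convex ℝ R) (hm : MeasurableSet R)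
    {W H : ℝ} (hW0 : 0 ≤ W) (hW : ∀ x x' y, (x, y) ∈ R → (x', y) ∈ R → x' - x ≤ W) (hH0 : 0 ≤ H)
    (hH : ∀ p ∈ R, 0 < p.2 ∧ p.2 ≤ H) {d : ℕ} (hd : d ≠ 0) (c₁ c₂ : ℤ)
    (hcd : ∀ m : ℕ, (m : ℤ) ∣ c₁ → (m : ℤ) ∣ c₂ → m ∣ d → m = 1) (P : Finset ℕ)
    (hP : ∀ (b : ℕ) (x : ℝ), (x, (b : ℝ)) ∈ R → b ∈ P) :
    |({p : ℤ × ℤ | IsCoprime p.1 p.2 ∧ p.1 ≡ c₁ [ZMOD d] ∧ p.2 ≡ c₂ [ZMOD d] ∧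
        ((p.1 : ℝ), (p.2 : ℝ)) ∈ R}.ncard : ℝ) - coprimeDensity d * area R| ≤
      ∑ b ∈ P, (b.divisors.card : ℝ) + W * (3 + Real.log (1 + H)) := by
  classical
  set M := ⌊H⌋₊
  have hMH : (M : ℝ) ≤ H := Nat.floor_le hH0
  have hd1 : (1 : ℝ) ≤ d := by exact_mod_cast Nat.one_le_iff_ne_zero.2 hd
  have hle : ∀ a b : ℤ, ((a : ℝ), (b : ℝ)) ∈ R → 0 < b ∧ b ≤ M := by
    intro a b hab
    have h1 : (0 : ℝ) < b ∧ (b : ℝ) ≤ H := hH _ hab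
    have h2 : 0 < b := by exact_mod_cast h1.1
    refine ⟨h2, ?_⟩
    lift b to ℕ using h2.le
    exact_mod_cast Nat.le_floor (by simpa using h1.2)
  set X : Set (ℤ × ℤ) := {p | p.1 ≡ c₁ [ZMOD d] ∧ p.2 ≡ c₂ [ZMOD d] ∧
        ((p.1 : ℝ), (p.2 : ℝ)) ∈ R} with hX
  have hXfin : X.Finite := by
    have hsec : ∀ b : ℤ, {a : ℤ | ((a : ℝ), (b : ℝ)) ∈ R}.Finite := by
      intro b
      refine finite_int_of_bounded (I := {x | (x, (b : ℝ)) ∈ R}) ?_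
      rcases Set.eq_empty_or_nonempty {x | (x, (b : ℝ)) ∈ R} with h | ⟨a, ha⟩
      · rw [h]; exact Bornology.isBounded_empty
      · exact (Metric.isBounded_Icc (a - W) (a + W)).subset fun x hx =>
          ⟨by linarith [hW _ _ _ hx ha], by linarith [hW _ _ _ ha hx]⟩
    refine ((Set.finite_Icc (0 : ℤ) M).biUnion fun b _ => (hsec b).image fun a => (a, b)).subset ?_
    rintro ⟨a, b⟩ hab
    simp only [mem_iUnion, mem_image]
    have := hle a b hab.2.2
    exact ⟨b, ⟨this.1.le, this.2⟩, a, hab.2.2, rfl⟩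
  set A : ℕ → Finset (ℤ × ℤ) := fun m =>
    hXfin.toFinset.filter fun p => (m : ℤ) ∣ p.1 ∧ (m : ℤ) ∣ p.2 with hA
  have hcount : ({p : ℤ × ℤ | IsCoprime p.1 p.2 ∧ p.1 ≡ c₁ [ZMOD d] ∧ p.2 ≡ c₂ [ZMOD d] ∧
        ((p.1 : ℝ), (p.2 : ℝ)) ∈ R}.ncard : ℤ) =
      ∑ m ∈ Finset.Icc 1 M, moebius m * (A m).card := by
    have : {p : ℤ × ℤ | IsCoprime p.1 p.2 ∧ p.1 ≡ c₁ [ZMOD d] ∧ p.2 ≡ c₂ [ZMOD d] ∧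
        ((p.1 : ℝ), (p.2 : ℝ)) ∈ R} = ↑(hXfin.toFinset.filter fun p => IsCoprime p.1 p.2) := by
      ext p
      simp [hX]; tauto
    rw [this, Set.ncard_coe_finset, ← Finset.sum_boole]
    rw [Finset.sum_congr rfl fun p hp => ite_isCoprime_eq_sum (M := M)
      (hle p.1 p.2 ((hXfin.mem_toFinset.1 hp).2.2)).1 (hle p.1 p.2 ((hXfin.mem_toFinset.1 hp).2.2)).2]
    rw [Finset.sum_comm]
    refine Finset.sum_congr rfl fun m _ => ?_
    rw [← Finset.sum_filter, Finset.sum_const, nsmul_eq_mul, mul_comm]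
  -- A common factor of `m` and `d` would divide both `c₁` and `c₂`, which `hcd` forbids. Thus only
  -- `m` coprime to `d` matter.
  have hempty : ∀ m : ℕ, ¬ m.Coprime d → (A m).card = 0 := by
    intro m hmd
    rw [Finset.card_eq_zero, Finset.eq_empty_iff_forall_notMem]
    intro p hp
    simp only [hA, Finset.mem_filter, Finite.mem_toFinset, hX, mem_ofPred_eq] at hp
    apply hmd
    have hgm : ((Nat.gcd m d : ℕ) : ℤ) ∣ m := by exact_mod_cast Nat.gcd_dvd_left m d
    have hgd : ((Nat.gcd m d : ℕ) : ℤ) ∣ d := by exact_mod_cast Nat.gcd_dvd_right m d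
    refine hcd (Nat.gcd m d) ?_ ?_ (Nat.gcd_dvd_right m d)
    · exact ((hp.1.1.of_dvd hgd).dvd_iff).1 (hgm.trans hp.2.1)
    · exact ((hp.1.2.1.of_dvd hgd).dvd_iff).1 (hgm.trans hp.2.2)
  have hmain : ∀ m ∈ Finset.Icc 1 M, m.Coprime d →
      |((A m).card : ℝ) - area R / ((m : ℝ) * d) ^ 2| ≤
        (P.filter fun b => 0 < b ∧ m ∣ b).card + W * (m : ℝ)⁻¹ := by
    intro m hmM hmd
    have hm1 : 1 ≤ m := (Finset.mem_Icc.1 hmM).1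
    have hm1' : (1 : ℝ) ≤ m := by exact_mod_cast hm1
    obtain ⟨e₁, he₁⟩ := exists_modEq_mul_iff hmd c₁
    obtain ⟨e₂, he₂⟩ := exists_modEq_mul_iff hmd c₂
    have h1 := abs_ncard_lattice_sub_area_le hc hm hW0 hW
      (fun p hp => ⟨(hH p hp).1.le, (hH p hp).2⟩) (h := m * d)
      (Nat.mul_pos hm1 (Nat.pos_of_ne_zero hd)) e₁ e₂
      ((P.filter fun b : ℕ => 0 < b ∧ m ∣ b ∧ (b : ℤ) ≡ c₂ [ZMOD d]).image ((↑) : ℕ → ℤ))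
      (by
        intro b hb
        obtain ⟨b, hb', rfl⟩ := Finset.mem_image.1 hb
        have hb := (Finset.mem_filter.1 hb').2
        exact (he₂ _).2 ⟨by exact_mod_cast hb.2.1, hb.2.2⟩)
      (by
        intro b hb x hx
        have hb1 : (0 : ℝ) < b := (hH _ hx).1
        have hb0 : 0 < b := by exact_mod_cast hb1
        obtain ⟨h2, h3⟩ := (he₂ _).1 hb
        lift b to ℕ using hb0.le
        refine Finset.mem_image.2 ⟨b, ?_, rfl⟩
        rw [Finset.mem_filter]
        exact ⟨hP b x (by simpa using hx), by exact_mod_cast hb0, by exact_mod_cast h2, h3⟩)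
    have h2 : {p : ℤ × ℤ | p.1 ≡ e₁ [ZMOD ((m * d : ℕ) : ℤ)] ∧ p.2 ≡ e₂ [ZMOD ((m * d : ℕ) : ℤ)] ∧
        ((p.1 : ℝ), (p.2 : ℝ)) ∈ R} = ↑(A m) := by
      ext p
      simp only [hA, Finset.coe_filter, Finite.mem_toFinset, hX, mem_ofPred_eq, he₁, he₂]
      tauto
    rw [h2, Set.ncard_coe_finset] at h1
    push_cast at h1
    refine h1.trans (add_le_add ?_ ?_)
    · refine Nat.cast_le.2 (Finset.card_image_le.trans (Finset.card_le_card ?_))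
      intro b
      simp only [Finset.mem_filter]
      tauto
    · rw [div_eq_mul_inv]
      refine mul_le_mul_of_nonneg_left ?_ hW0
      exact inv_anti₀ (by linarith) (by nlinarith)
  have harea0 : 0 ≤ area R := ENNReal.toReal_nonneg
  have hareaW : area R ≤ W * H := by
    rw [area, Measure.volume_eq_prod, Measure.prod_apply_symm hm]
    refine ENNReal.toReal_le_of_le_ofReal (by positivity) ?_
    calc ∫⁻ y, volume ((fun x => (x, y)) ⁻¹' R)
        ≤ ∫⁻ y, (Icc 0 H).indicator (fun _ => ENNReal.ofReal W) y := by
          refine lintegral_mono fun y => ?_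
          by_cases hy : y ∈ Icc 0 H
          · rw [indicator_of_mem hy]
            refine (Real.volume_le_diam _).trans (Metric.ediam_le fun x hx x' hx' => ?_)
            rw [edist_dist]
            refine ENNReal.ofReal_le_ofReal ?_
            rw [Real.dist_eq, abs_le]
            constructor <;> linarith [hW x x' y hx hx', hW x' x y hx' hx]
          · rw [indicator_of_notMem hy]
            have : (fun x => (x, y)) ⁻¹' R = ∅ := by
              ext x
              simp only [mem_preimage, mem_empty_iff_false, iff_false]
              exact fun hx => hy ⟨(hH _ hx).1.le, (hH _ hx).2⟩
            rw [this]; simp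
      _ = ENNReal.ofReal (W * H) := by
          rw [lintegral_indicator measurableSet_Icc, setLIntegral_const, Real.volume_Icc, sub_zero,
            ENNReal.ofReal_mul hW0]
  set S : ℝ := ∑ m ∈ Finset.Icc 1 M, (if m.Coprime d then (moebius m : ℝ) / (m : ℝ) ^ 2 else 0)
    with hS
  have hcountR : ({p : ℤ × ℤ | IsCoprime p.1 p.2 ∧ p.1 ≡ c₁ [ZMOD d] ∧ p.2 ≡ c₂ [ZMOD d] ∧
        ((p.1 : ℝ), (p.2 : ℝ)) ∈ R}.ncard : ℝ) =
      ∑ m ∈ Finset.Icc 1 M, (moebius m : ℝ) * ((A m).card : ℝ) := by exact_mod_cast hcount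
  have hE1 : |({p : ℤ × ℤ | IsCoprime p.1 p.2 ∧ p.1 ≡ c₁ [ZMOD d] ∧ p.2 ≡ c₂ [ZMOD d] ∧
        ((p.1 : ℝ), (p.2 : ℝ)) ∈ R}.ncard : ℝ) - S * (area R / (d : ℝ) ^ 2)| ≤
      ∑ m ∈ Finset.Icc 1 M,
        (((P.filter fun b => 0 < b ∧ m ∣ b).card : ℝ) + W * (m : ℝ)⁻¹) := by
    rw [hcountR, hS, Finset.sum_mul, ← Finset.sum_sub_distrib]
    refine (Finset.abs_sum_le_sum_abs _ _).trans (Finset.sum_le_sum fun m hmM => ?_)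
    split_ifs with hmd
    · have : (moebius m : ℝ) * ((A m).card : ℝ) - (moebius m : ℝ) / (m : ℝ) ^ 2 *
          (area R / (d : ℝ) ^ 2) =
          (moebius m : ℝ) * (((A m).card : ℝ) - area R / ((m : ℝ) * d) ^ 2) := by
        rw [mul_pow]; field_simp
      rw [this, abs_mul]
      refine (mul_le_of_le_one_left (abs_nonneg _) ?_).trans (hmain m hmM hmd)
      exact_mod_cast abs_moebius_le_one
    · rw [hempty m hmd]
      simp
      positivity
  -- For each `m` only the rows with `m ∣ b` are met; after exchanging the sums, each row `b` is
  -- counted at most as often as it has divisors.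
  have hE2 : ∑ m ∈ Finset.Icc 1 M, ((P.filter fun b => 0 < b ∧ m ∣ b).card : ℝ) ≤
      ∑ b ∈ P, (b.divisors.card : ℝ) := by
    simp_rw [← Finset.sum_boole]
    rw [Finset.sum_comm]
    refine Finset.sum_le_sum fun b _ => ?_
    rw [Finset.sum_boole]
    refine Nat.cast_le.2 (Finset.card_le_card fun m => ?_)
    rw [Finset.mem_filter, Nat.mem_divisors]
    exact fun h => ⟨h.2.2, h.2.1.ne'⟩
  -- The tail of the Möbius series is at most `2 / (M + 1)`, and the area is at most `W * H` with `H
  -- < M + 1`.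
  have hE3 : |S * (area R / (d : ℝ) ^ 2) - coprimeDensity d * area R| ≤ 2 * W := by
    have h1 := abs_sum_moebius_coprime_sub_le hd M
    have h2 : S * (area R / (d : ℝ) ^ 2) - coprimeDensity d * area R =
      (S - 6 / Real.pi ^ 2 * (∏ p ∈ d.primeFactors, (1 - 1 / (p : ℝ) ^ 2)⁻¹)) *
        (area R / (d : ℝ) ^ 2) := by
      rw [coprimeDensity]; ring
    have h3 : area R / (d : ℝ) ^ 2 ≤ W * H :=
      (div_le_self harea0 (by nlinarith)).trans hareaW
    rw [h2, abs_mul, abs_of_nonneg (by positivity : 0 ≤ area R / (d : ℝ) ^ 2)]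
    have hHM : H < M + 1 := Nat.lt_floor_add_one H
    calc _ ≤ (2 : ℝ) / ((M : ℝ) + 1) * (W * H) := by gcongr
      _ = 2 * W * (H / (M + 1)) := by ring
      _ ≤ 2 * W * 1 := by
        gcongr
        rw [div_le_one (by positivity)]; exact hHM.le
      _ = 2 * W := by ring
  rw [Finset.sum_add_distrib, ← Finset.mul_sum] at hE1
  have hE4 := mul_le_mul_of_nonneg_left (sum_Icc_inv_le_one_add_log hMH hH0) hW0
  rw [abs_le] at *
  constructor <;> nlinarith [hE1.1, hE1.2, hE3.1, hE3.2]

/-! ### The Farey map and its polygons -/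

theorem fareyTriangle_snd_pos {p : ℝ × ℝ} (h : p ∈ fareyTriangle) : 0 < p.2 := by
  have h1 := h.1; have h2 := h.2.2; linarith

theorem fareyL_add_two (x y : ℝ) (j : ℕ) :
    fareyL x y (j + 2) = fareyIndex x y j * fareyL x y (j + 1) - fareyL x y j := rfl

theorem fareyL_shift (x y : ℝ) (j n : ℕ) :
    fareyL x y (j + n) = fareyL (fareyL x y j) (fareyL x y (j + 1)) n := by
  induction n using Nat.twoStepInduction with
  | zero => rfl
  | one => rfl
  | more n ih1 ih2 =>
    rw [← add_assoc, fareyL_add_two, fareyL_add_two, fareyIndex, fareyIndex, add_assoc j n 1, ih1, ih2]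

theorem fareyIndex_shift (x y : ℝ) (j n : ℕ) :
    fareyIndex x y (j + n) = fareyIndex (fareyL x y j) (fareyL x y (j + 1)) n := by
  rw [fareyIndex, fareyIndex, add_assoc j n 1, fareyL_shift x y j n, fareyL_shift x y j (n + 1)]

/-- The two inequalities defining the integer part say precisely that the new term is at most `1`
and that its sum with the preceding term exceeds `1`. -/
theorem fareyL_mem_fareyTriangle {x y : ℝ} (h : (x, y) ∈ fareyTriangle) (j : ℕ) :
    (fareyL x y j, fareyL x y (j + 1)) ∈ fareyTriangle := by
  induction j with
  | zero => exact h
  | succ j ih =>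
    have hpos := fareyTriangle_snd_pos ih
    obtain ⟨h1, h2, h3⟩ := ih
    simp only at hpos h1 h2 h3
    refine ⟨h2, ?_, ?_⟩
    · have := Int.floor_le ((1 + fareyL x y j) / fareyL x y (j + 1))
      rw [le_div_iff₀ hpos] at this
      simp only [fareyL]
      linarith
    · have := Int.lt_floor_add_one ((1 + fareyL x y j) / fareyL x y (j + 1))
      rw [div_lt_iff₀ hpos] at this
      simp only [fareyL]
      linarith

theorem fareyL_succ_pos {x y : ℝ} (h : (x, y) ∈ fareyTriangle) (j : ℕ) :
    0 < fareyL x y (j + 1) :=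
  fareyTriangle_snd_pos (fareyL_mem_fareyTriangle h j)

theorem fareyIndex_eq_iff {x y : ℝ} {j : ℕ} (h : 0 < fareyL x y (j + 1)) (k : ℤ) :
    fareyIndex x y j = k ↔ k * fareyL x y (j + 1) ≤ 1 + fareyL x y j ∧
      1 + fareyL x y j < (k + 1) * fareyL x y (j + 1) := by
  rw [fareyIndex, Int.floor_eq_iff, le_div_iff₀ h, div_lt_iff₀ h]

theorem fareyIndex_pos {x y : ℝ} (h : (x, y) ∈ fareyTriangle) (j : ℕ) : 0 < fareyIndex x y j := by
  have h1 := fareyL_mem_fareyTriangle h j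
  have hpos := fareyL_succ_pos h j
  have h2 := h1.2.1
  have h3 := h1.2.2
  simp only at h2 h3
  rw [fareyIndex, Int.floor_pos, le_div_iff₀ hpos]
  rcases j with _ | j
  · have h4 := h.2.1; have h5 := h.2.2; simp only at h4 h5; simp only [fareyL] at *; linarith
  · linarith [fareyL_succ_pos h j]

/-- The recursion can be run backwards: the term `u` before `v` lies in `(1 - v, 1]`, an interval of
length `v`, and the term after `v` determines `u` modulo `v`. -/
theorem fareyL_injective {x y x' y' : ℝ} (h : (x, y) ∈ fareyTriangle)
    (h' : (x', y') ∈ fareyTriangle) (j : ℕ) (h0 : fareyL x y j = fareyL x' y' j)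
    (h1 : fareyL x y (j + 1) = fareyL x' y' (j + 1)) : x = x' ∧ y = y' := by
  induction j with
  | zero => exact ⟨h0, h1⟩
  | succ j ih =>
    refine ih ?_ h0
    have hm := fareyL_mem_fareyTriangle h j
    have hm' := fareyL_mem_fareyTriangle h' j
    have hpos := fareyL_succ_pos h' j
    rw [fareyL_add_two, fareyL_add_two, h0] at h1
    rw [h0] at hm
    generalize fareyL x' y' (j + 1) = v at *
    generalize fareyL x y j = u at *
    generalize fareyL x' y' j = u' at *
    generalize fareyIndex x y j = k at *
    generalize fareyIndex x' y' j = k' at *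
    obtain ⟨a1, -, a3⟩ := hm
    obtain ⟨b1, -, b3⟩ := hm'
    simp only at a1 a3 b1 b3
    have hk : k = k' := by
      apply le_antisymm
      · by_contra! hlt
        have : (k' : ℝ) + 1 ≤ k := by exact_mod_cast hlt
        nlinarith
      · by_contra! hlt
        have : (k : ℝ) + 1 ≤ k' := by exact_mod_cast hlt
        nlinarith
    rw [hk] at h1
    linarith

theorem convex_fareyTriangle : Convex ℝ fareyTriangle := by
  rintro ⟨a, b⟩ ⟨h1, h2, h3⟩ ⟨a', b'⟩ ⟨h1', h2', h3'⟩ u v hu hv huv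
  simp only at h1 h2 h3 h1' h2' h3'
  refine ⟨?_, ?_, ?_⟩ <;> simp only [Prod.smul_mk, Prod.mk_add_mk, smul_eq_mul]
  · nlinarith
  · nlinarith
  · have h4 : 0 ≤ u * (a + b - 1) := mul_nonneg hu (by linarith)
    have h5 : 0 ≤ v * (a' + b' - 1) := mul_nonneg hv (by linarith)
    rcases hu.eq_or_lt with rfl | hu'
    · have : v = 1 := by linarith
      subst this; linarith
    · have h4 : 0 < u * (a + b - 1) := mul_pos hu' (by linarith)
      nlinarith

/-- With the earlier indices fixed, each term is a fixed linear form in the starting point, so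
prescribing the next index amounts to two linear inequalities. -/
theorem convex_polygon {s : ℕ} (k : Fin s → ℕ) : Convex ℝ (polygon k) := by
  intro p hp q hq u v hu hv huv
  have hz := convex_fareyTriangle hp.1 hq.1 hu hv huv
  change u • p + v • q ∈ polygon k
  generalize hzdef : u • p + v • q = z at hz ⊢
  have key : ∀ n ≤ s, fareyL z.1 z.2 n = u * fareyL p.1 p.2 n + v * fareyL q.1 q.2 n ∧
      fareyL z.1 z.2 (n + 1) = u * fareyL p.1 p.2 (n + 1) + v * fareyL q.1 q.2 (n + 1) ∧
      ∀ i : Fin s, (i : ℕ) < n → fareyIndex z.1 z.2 i = (k i : ℤ) := by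
    intro n
    induction n with
    | zero =>
      subst hzdef
      intro _; exact ⟨rfl, rfl, fun i hi => absurd hi (Nat.not_lt_zero _)⟩
    | succ n ih =>
      intro hn
      obtain ⟨h1, h2, h3⟩ := ih (by omega)
      have hpi := hp.2 ⟨n, hn⟩
      have hqi := hq.2 ⟨n, hn⟩
      have hidx : fareyIndex z.1 z.2 n = (k ⟨n, hn⟩ : ℤ) := by
        have hpi' := (fareyIndex_eq_iff (fareyL_succ_pos hp.1 n) _).1 hpi
        have hqi' := (fareyIndex_eq_iff (fareyL_succ_pos hq.1 n) _).1 hqi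
        rw [fareyIndex_eq_iff (fareyL_succ_pos hz n), h1, h2]
        generalize fareyL p.1 p.2 n = a at *
        generalize fareyL p.1 p.2 (n + 1) = b at *
        generalize fareyL q.1 q.2 n = a' at *
        generalize fareyL q.1 q.2 (n + 1) = b' at *
        push_cast at *
        generalize (k ⟨n, hn⟩ : ℝ) = κ at *
        constructor
        · nlinarith [mul_le_mul_of_nonneg_left hpi'.1 hu, mul_le_mul_of_nonneg_left hqi'.1 hv]
        · rcases hu.eq_or_lt with rfl | hu'
          · have : v = 1 := by linarith
            subst this; linarith [hqi'.2]
          · nlinarith [mul_lt_mul_of_pos_left hpi'.2 hu', mul_le_mul_of_nonneg_left hqi'.2.le hv]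
      refine ⟨h2, ?_, ?_⟩
      · rw [fareyL_add_two, fareyL_add_two, fareyL_add_two, hidx, hpi, hqi, h1, h2]; ring
      · intro i hi
        rcases Nat.lt_succ_iff_lt_or_eq.1 hi with h | h
        · exact h3 i h
        · have : i = ⟨n, hn⟩ := Fin.ext h
          subst this; exact hidx
  exact ⟨hz, fun j => (key s le_rfl).2.2 j j.2⟩

theorem measurable_fareyL (j : ℕ) : Measurable fun p : ℝ × ℝ => fareyL p.1 p.2 j := by
  induction j using Nat.twoStepInduction with
  | zero => exact measurable_fst
  | one => exact measurable_snd
  | more j ih1 ih2 =>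
    simp only [fareyL]
    have h : Measurable fun p : ℝ × ℝ =>
        ⌊(1 + fareyL p.1 p.2 j) / fareyL p.1 p.2 (j + 1)⌋ :=
      ((measurable_const.add ih1).div ih2).floor
    exact ((measurable_from_top (f := ((↑) : ℤ → ℝ))).comp h |>.mul ih2).sub ih1

theorem measurable_fareyIndex (j : ℕ) : Measurable fun p : ℝ × ℝ => fareyIndex p.1 p.2 j :=
  ((measurable_const.add (measurable_fareyL j)).div (measurable_fareyL (j + 1))).floor

theorem measurableSet_fareyTriangle : MeasurableSet fareyTriangle :=
  (measurableSet_le measurable_fst measurable_const).inter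
    ((measurableSet_le measurable_snd measurable_const).inter
      (measurableSet_lt measurable_const (measurable_fst.add measurable_snd)))

theorem measurableSet_polygon {s : ℕ} (k : Fin s → ℕ) : MeasurableSet (polygon k) := by
  have : polygon k = fareyTriangle ∩ ⋂ j : Fin s,
      (fun p : ℝ × ℝ => fareyIndex p.1 p.2 j) ⁻¹' {(k j : ℤ)} := by
    ext p; simp [polygon]
  rw [this]
  exact measurableSet_fareyTriangle.inter
    (MeasurableSet.iInter fun j => measurable_fareyIndex j (measurableSet_singleton _))

/-! ### Polygons with a large index -/

/-- The polygon of the points whose first index is `k`. -/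
abbrev firstPolygon (k : ℕ) : Set (ℝ × ℝ) := polygon fun _ : Fin 1 => k

theorem mem_firstPolygon {k : ℕ} {p : ℝ × ℝ} :
    p ∈ firstPolygon k ↔ p ∈ fareyTriangle ∧ fareyIndex p.1 p.2 0 = k := by
  simp [polygon]

/-- From `k y ≤ 1 + x ≤ 2` and `(k + 1) y > 1 + x > 2 - y`: a large index forces `y` to be close to
`2 / k`. -/
theorem firstPolygon_bounds {k : ℕ} {p : ℝ × ℝ} (h : p ∈ firstPolygon k) :
    k * p.2 ≤ 2 ∧ 2 < (k + 2) * p.2 := by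
  rw [mem_firstPolygon] at h
  have hpos := fareyTriangle_snd_pos h.1
  have h1 := (fareyIndex_eq_iff (j := 0) hpos _).1 h.2
  obtain ⟨h2, h3, h4⟩ := h.1
  simp only [fareyL] at h1
  push_cast at h1
  constructor <;> linarith [h1.1, h1.2]

/-- An index `2` continues an arithmetic progression. The two hypotheses are the floor inequalities
for the value `2`, simplified along the progression. -/
theorem fareyL_of_arithmetic {a δ : ℝ} {n : ℕ}
    (h : ∀ i < n, a + (i + 2) * δ ≤ 1 ∧ 1 < 2 * a + (2 * i + 3) * δ) :
    (∀ i ≤ n, fareyL a (a + δ) i = a + i * δ ∧ fareyL a (a + δ) (i + 1) = a + (i + 1) * δ) ∧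
      ∀ i < n, fareyIndex a (a + δ) i = 2 := by
  have key : ∀ i ≤ n, (fareyL a (a + δ) i = a + i * δ ∧
      fareyL a (a + δ) (i + 1) = a + (i + 1) * δ) ∧
      (i < n → fareyIndex a (a + δ) i = 2) := by
    intro i
    induction i with
    | zero =>
      intro _
      refine ⟨⟨by simp [fareyL], by simp [fareyL]⟩, fun hn => ?_⟩
      have := h 0 hn
      push_cast at this
      have hp : 0 < fareyL a (a + δ) (0 + 1) := by simp only [fareyL]; linarith
      rw [fareyIndex_eq_iff hp]
      simp only [fareyL]
      push_cast
      constructor <;> linarith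
    | succ i ih =>
      intro hi
      obtain ⟨⟨h1, h2⟩, h3⟩ := ih (by omega)
      have h4 : fareyL a (a + δ) (i + 1 + 1) = a + ((i + 1 : ℕ) + 1) * δ := by
        rw [fareyL_add_two, h3 (by omega), h1, h2]; push_cast; ring
      refine ⟨⟨by push_cast; exact h2, h4⟩, fun hn => ?_⟩
      have := h (i + 1) hn
      push_cast at this h4
      have hp : 0 < fareyL a (a + δ) (i + 1 + 1) := by rw [h4]; linarith
      rw [fareyIndex_eq_iff hp, h4, h2]
      push_cast
      constructor <;> linarith
  exact ⟨fun i hi => (key i hi).1, fun i hi => (key i hi.le).2 hi⟩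

/-- The vector `(2, …, 2, 1, k, 1, 2, …, 2)` with `k` in position `j`. -/
def peakVector (s j k : ℕ) (i : Fin s) : ℕ :=
  if (i : ℕ) = j then k else if (i : ℕ) + 1 = j ∨ (i : ℕ) = j + 1 then 1 else 2

/-- The point whose `j`-th iterate is `p` if `p` is close to the vertex `(1, 0)`. -/
def pullBack {A : Type*} [Ring A] (j : ℕ) (p : A × A) : A × A :=
  if j = 0 then p else (p.1 - j * p.2, p.1 - (j - 1) * p.2)

/-- If `y` is small, then `x` and the term `x'` after `y` are within `y` of `1`. The sequence climbs
`…, x - 2y, x - y, x`, drops to `y`, jumps to `x'` and descends `x' - y, x' - 2y, …`. The slopes are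
constant on both sides, so the indices are `2` except at the peak and its two neighbours; the bound
on `y` keeps all `s` indices in this regime. -/
theorem pullBack_mem_polygon {s j k : ℕ} (hj : j < s) {p : ℝ × ℝ} (hp : p ∈ firstPolygon k)
    (hy : (2 * s + 6) * p.2 < 1) :
    pullBack j p ∈ polygon (peakVector s j k) ∧
      fareyL (pullBack j p).1 (pullBack j p).2 j = p.1 ∧
      fareyL (pullBack j p).1 (pullBack j p).2 (j + 1) = p.2 := by
  obtain ⟨x, y⟩ := p
  rw [mem_firstPolygon] at hp
  obtain ⟨hT, hk⟩ := hp
  have hy0 : 0 < y := fareyTriangle_snd_pos hT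
  obtain ⟨hx1, hy1, hxy⟩ := id hT
  simp only at hx1 hy1 hxy hk hy
  have hjs : (j : ℝ) + 1 ≤ s := by exact_mod_cast hj
  have hjy : (2 * j + 8) * y < 1 := by nlinarith
  have hback : (pullBack j (x, y) ∈ fareyTriangle) ∧
      fareyL (pullBack j (x, y)).1 (pullBack j (x, y)).2 j = x ∧
      fareyL (pullBack j (x, y)).1 (pullBack j (x, y)).2 (j + 1) = y ∧
      ∀ i < j, fareyIndex (pullBack j (x, y)).1 (pullBack j (x, y)).2 i =
        if i + 1 = j then 1 else 2 := by
    rcases Nat.eq_zero_or_pos j with rfl | hpos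
    · simp only [pullBack]
      exact ⟨hT, rfl, rfl, fun i hi => absurd hi (Nat.not_lt_zero _)⟩
    · obtain ⟨m, rfl⟩ : ∃ m, j = m + 1 := ⟨j - 1, by omega⟩
      have hP : (pullBack (m + 1) (x, y) : ℝ × ℝ) = (x - (m + 1) * y, x - (m + 1) * y + y) := by
        simp [pullBack]; ring
      rw [hP]
      push_cast at hjy
      simp only
      have hm0 : (0 : ℝ) ≤ m * y := by positivity
      have hAP := fareyL_of_arithmetic (a := x - (m + 1) * y) (δ := y) (n := m) (by
        intro i hi
        have hi' : (i : ℝ) + 1 ≤ m := by exact_mod_cast hi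
        have : 0 ≤ (i : ℝ) * y := by positivity
        have h2 := mul_le_mul_of_nonneg_right hi' hy0.le
        constructor <;> nlinarith)
      obtain ⟨hL, hI⟩ := hAP
      obtain ⟨hL1, hL2⟩ := hL m le_rfl
      have hL1' : fareyL (x - (m + 1) * y) (x - (m + 1) * y + y) m = x - y := by rw [hL1]; ring
      have hL2' : fareyL (x - (m + 1) * y) (x - (m + 1) * y + y) (m + 1) = x := by rw [hL2]; ring
      have hidx : fareyIndex (x - (m + 1) * y) (x - (m + 1) * y + y) m = 1 := by
        rw [fareyIndex_eq_iff (by rw [hL2']; nlinarith), hL1', hL2']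
        push_cast
        constructor <;> linarith
      refine ⟨⟨?_, ?_, ?_⟩, hL2', ?_, ?_⟩
      · simp only; nlinarith
      · simp only; nlinarith
      · simp only; nlinarith
      · rw [fareyL_add_two, hidx, hL1', hL2']; push_cast; ring
      · intro i hi
        rcases Nat.lt_succ_iff_lt_or_eq.1 hi with h | rfl
        · rw [hI i h, if_neg (by omega)]
        · rw [hidx, if_pos rfl]
  obtain ⟨hPT, hLj, hLj1, hI⟩ := hback
  generalize pullBack j (x, y) = P at *
  refine ⟨⟨hPT, ?_⟩, hLj, hLj1⟩
  intro i
  rw [peakVector]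
  rcases lt_trichotomy (i : ℕ) j with hij | hij | hij
  · rw [hI i hij, if_neg hij.ne]
    by_cases h : (i : ℕ) + 1 = j
    · simp [h]
    · have h' : ¬ (i : ℕ) = j + 1 := by omega
      simp [h, h']
  · rw [if_pos hij, hij]
    have := fareyIndex_shift P.1 P.2 j 0
    rw [hLj, hLj1] at this
    rw [← hk, ← this, add_zero]
  · rw [if_neg hij.ne']
    obtain ⟨n, hn⟩ : ∃ n, (i : ℕ) = j + 1 + n := ⟨i - (j + 1), by omega⟩
    have hns : (n : ℝ) + 2 ≤ s := by
      have h1 := i.2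
      have : n + 2 ≤ s := by omega
      exact_mod_cast this
    have hny : (2 * n + 10) * y < 1 := by nlinarith
    have hn0 : (0 : ℝ) ≤ n * y := by positivity
    set x' := fareyL x y 2 with hx'
    have hT' := fareyL_mem_fareyTriangle hT 1
    obtain ⟨-, hx'1, hx'y⟩ := hT'
    simp only [fareyL_add_two] at hx'1 hx'y
    change fareyL x y 2 ≤ 1 at hx'1
    change 1 < y + fareyL x y 2 at hx'y
    rw [← hx'] at hx'1 hx'y
    have hidx1 : fareyIndex x y 1 = 1 := by
      rw [fareyIndex_eq_iff (fareyL_succ_pos hT 1)]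
      change ((1 : ℤ) : ℝ) * x' ≤ 1 + y ∧ 1 + y < (((1 : ℤ) : ℝ) + 1) * x'
      push_cast
      constructor <;> nlinarith
    have hL3 : fareyL x y 3 = x' + (-y) := by
      rw [fareyL_add_two, hidx1]
      change ((1 : ℤ) : ℝ) * x' - y = _
      push_cast; ring
    have hsh : fareyIndex P.1 P.2 i = fareyIndex x y (1 + n) := by
      rw [hn, add_assoc, fareyIndex_shift, hLj, hLj1]
    rw [hsh]
    rcases Nat.eq_zero_or_pos n with rfl | hpos
    · rw [hidx1, if_pos (Or.inr (by omega))]; rfl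
    · rw [if_neg (by omega)]
      obtain ⟨m, rfl⟩ : ∃ m, n = m + 1 := ⟨n - 1, by omega⟩
      push_cast at hny hn0
      have hm0 : (0 : ℝ) ≤ m * y := by positivity
      -- The descending branch, an arithmetic progression with difference `-y` starting two steps
      -- after `x`.
      have hAP := (fareyL_of_arithmetic (a := x') (δ := -y) (n := m + 1) (by
        intro t ht
        have ht' : (t : ℝ) ≤ m := by exact_mod_cast (Nat.lt_succ_iff.1 ht)
        have h0 : 0 ≤ (t : ℝ) * y := by positivity
        have h2 := mul_le_mul_of_nonneg_right ht' hy0.le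
        constructor <;> nlinarith)).2 m (Nat.lt_succ_self m)
      have := fareyIndex_shift x y 2 m
      rw [hL3, ← hx', hAP] at this
      rw [show 1 + (m + 1) = 2 + m by ring, this]; rfl

/-- The threshold is chosen so that `k y ≤ 2` gives `(2 s + 6) y ≤ (4 s + 12) / (4 s + 13) < 1`. The
pulled-back point and `p` then share their terms `j` and `j + 1`, so they coincide by
`fareyL_injective`. -/
theorem exists_pullBack_eq {s j k : ℕ} (hj : j < s) (hk : 4 * s + 13 ≤ k) {p : ℝ × ℝ}
    (hp : p ∈ fareyTriangle) (hi : fareyIndex p.1 p.2 j = k) :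
    ∃ q ∈ firstPolygon k, (2 * s + 6) * q.2 < 1 ∧ pullBack j q = p := by
  set q : ℝ × ℝ := (fareyL p.1 p.2 j, fareyL p.1 p.2 (j + 1)) with hq
  have hqT : q ∈ fareyTriangle := fareyL_mem_fareyTriangle hp j
  have hqk : q ∈ firstPolygon k := by
    rw [mem_firstPolygon]
    refine ⟨hqT, ?_⟩
    rw [← hi, ← add_zero j, fareyIndex_shift]
  have hy : (2 * s + 6) * q.2 < 1 := by
    have h1 := (firstPolygon_bounds hqk).1
    have h2 := fareyTriangle_snd_pos hqT
    have h3 : (4 * (s : ℝ) + 13) ≤ k := by exact_mod_cast hk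
    nlinarith
  refine ⟨q, hqk, hy, ?_⟩
  obtain ⟨h1, h2, h3⟩ := pullBack_mem_polygon hj hqk hy
  obtain ⟨h4, h5⟩ := fareyL_injective h1.1 hp j h2 h3
  exact Prod.ext h4 h5

theorem polygon_peakVector {s j k : ℕ} (hj : j < s) (hk : 4 * s + 13 ≤ k) :
    polygon (peakVector s j k) = pullBack j '' firstPolygon k := by
  ext p
  constructor
  · intro hp
    have hi := hp.2 ⟨j, hj⟩
    simp only [peakVector, if_true] at hi
    obtain ⟨q, h1, -, h2⟩ := exists_pullBack_eq hj hk hp.1 hi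
    exact ⟨q, h1, h2⟩
  · rintro ⟨q, hq, rfl⟩
    refine (pullBack_mem_polygon hj hq ?_).1
    have h1 := (firstPolygon_bounds hq).1
    have h2 := fareyTriangle_snd_pos hq.1
    have h3 : (4 * (s : ℝ) + 13) ≤ k := by exact_mod_cast hk
    nlinarith

/-- A vector of a point of the Farey triangle that has a large component is a peak vector. -/
theorem eq_peakVector {s : ℕ} {k : Fin s → ℕ} {j : Fin s} (hk : 4 * s + 13 ≤ k j) {p : ℝ × ℝ}
    (hp : p ∈ polygon k) : k = peakVector s j (k j) := by
  obtain ⟨q, h1, h3, h2⟩ := exists_pullBack_eq j.2 hk hp.1 (hp.2 j)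
  have h4 := (pullBack_mem_polygon j.2 h1 h3).1
  rw [h2] at h4
  ext i
  have := (hp.2 i).symm.trans (h4.2 i)
  exact_mod_cast this

/-- The map is linear of determinant `1`. -/
theorem area_pullBack_image (j : ℕ) (S : Set (ℝ × ℝ)) : area (pullBack j '' S) = area S := by
  rcases Nat.eq_zero_or_pos j with rfl | hj
  · congr 1
    convert! Set.image_id S using 1
  · set M : Matrix (Fin 2) (Fin 2) ℝ := !![1, -(j : ℝ); 1, -((j : ℝ) - 1)] with hM
    set f := Matrix.toLin (Module.Basis.finTwoProd ℝ) (Module.Basis.finTwoProd ℝ) M with hf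
    have h1 : (pullBack j : ℝ × ℝ → ℝ × ℝ) = f := by
      ext p
      · rw [hf, hM, Matrix.toLin_finTwoProd_apply]
        simp only [pullBack, if_neg hj.ne']; ring
      · rw [hf, hM, Matrix.toLin_finTwoProd_apply]
        simp only [pullBack, if_neg hj.ne']; ring
    have hdet : LinearMap.det f = 1 := by
      rw [hf, LinearMap.det_toLin, hM, Matrix.det_fin_two_of]; ring
    rw [area, h1, Measure.addHaar_image_linearMap, hdet]
    simp [area]

/-- The polygon fits in a rectangle of width `2 / k` and height `2 / k - 2 / (k + 2) = 4 / (k (k +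
2))`. -/
theorem area_firstPolygon_le {k : ℕ} (hk : 0 < k) : area (firstPolygon k) ≤ 8 / (k : ℝ) ^ 3 := by
  have hk' : (0 : ℝ) < k := by exact_mod_cast hk
  have hsub : firstPolygon k ⊆ Icc (1 - 2 / (k : ℝ)) 1 ×ˢ Icc (2 / ((k : ℝ) + 2)) (2 / (k : ℝ)) := by
    intro p hp
    obtain ⟨h1, h2⟩ := firstPolygon_bounds hp
    obtain ⟨h3, h4, h5⟩ := hp.1
    have h6 : p.2 ≤ 2 / (k : ℝ) := by rw [le_div_iff₀ hk']; linarith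
    refine ⟨⟨by linarith, h3⟩, ?_, h6⟩
    rw [div_le_iff₀ (by positivity)]; linarith
  have hle : 2 / ((k : ℝ) + 2) ≤ 2 / (k : ℝ) := by gcongr; linarith
  have h1 : area (firstPolygon k) ≤ 2 / k * (2 / k - 2 / (k + 2)) := by
    refine ENNReal.toReal_le_of_le_ofReal (by have : 0 ≤ 2 / (k : ℝ) - 2 / (k + 2) := by linarith
                                              positivity) ?_
    refine (measure_mono hsub).trans (le_of_eq ?_)
    rw [Measure.volume_eq_prod, Measure.prod_prod, Real.volume_Icc, Real.volume_Icc,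
      ← ENNReal.ofReal_mul (by rw [sub_sub_cancel]; positivity)]
    congr 2; ring
  refine h1.trans ?_
  rw [div_sub_div _ _ hk'.ne' (by positivity), div_mul_div_comm, div_le_div_iff₀ (by positivity) (by positivity)]
  have : (0 : ℝ) ≤ (k : ℝ) ^ 4 := by positivity
  nlinarith [pow_pos hk' 3]

/-! ### Neighbours in the Farey sequence -/

theorem finite_fareySet (Q : ℕ) : (fareySet Q).Finite := by
  refine (((Set.finite_Icc (0 : ℤ) Q).prod (Set.finite_Icc (0 : ℕ) Q)).image
    fun p : ℤ × ℕ => (p.1 : ℚ) / p.2).subset ?_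
  rintro f ⟨h0, h1, h2⟩
  refine ⟨(f.num, f.den), ⟨⟨Rat.num_nonneg.2 h0, ?_⟩, ⟨Nat.zero_le _, h2⟩⟩, Rat.num_div_den f⟩
  have h3 := Rat.le_iff f 1 |>.1 h1
  simp at h3
  simp only
  omega

/-- `g` is the successor of `f` in the Farey sequence of order `Q`. -/
def IsNextFarey (Q : ℕ) (f g : ℚ) : Prop :=
  f ∈ fareySet Q ∧ g ∈ fareySet Q ∧ f < g ∧ ∀ h ∈ fareySet Q, ¬ (f < h ∧ h < g)

theorem IsNextFarey.eq {Q : ℕ} {f g h : ℚ} (h1 : IsNextFarey Q f g) (h2 : IsNextFarey Q f h) :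
    g = h := by
  rcases lt_trichotomy g h with hlt | heq | hlt
  · exact absurd ⟨h1.2.2.1, hlt⟩ (h2.2.2.2 g h1.2.1)
  · exact heq
  · exact absurd ⟨h2.2.2.1, hlt⟩ (h1.2.2.2 h h2.2.1)

/-- The successor of `a / b` is the solution of `a' b - a b' = 1` with the largest `b' ≤ Q`. Such
`b'` form one class modulo `b`, so `b' > Q - b`. -/
theorem exists_isNextFarey {Q : ℕ} {f : ℚ} (hf : f ∈ fareySet Q) (hf1 : f < 1) :
    ∃ g, IsNextFarey Q f g ∧ Q < f.den + g.den ∧ g.num * f.den - f.num * g.den = 1 := by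
  obtain ⟨h0, -, hQ⟩ := id hf
  have ha0 : 0 ≤ f.num := Rat.num_nonneg.2 h0
  have hb0 : (0 : ℤ) < f.den := by exact_mod_cast f.den_pos
  have hab : f.num < f.den := by
    have := Rat.lt_iff f 1 |>.1 hf1
    simpa using this
  obtain ⟨u, v, huv⟩ := Rat.isCoprime_num_den f
  set a := f.num
  have hmod0 := Int.emod_nonneg (Q + u) hb0.ne'
  have hmod1 := Int.emod_lt_of_pos (Q + u) hb0
  have hdm := Int.emod_add_mul_ediv (Q + u) f.den
  set b' : ℤ := Q - (Q + u) % f.den with hb'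
  set t := ((Q : ℤ) + u) / f.den
  have hbu : b' = f.den * t - u := by linarith
  have hb'1 : 0 < b' := by have : (f.den : ℤ) ≤ Q := by exact_mod_cast hQ
                           omega
  set a' : ℤ := a * t + v with ha'
  have hdet : a' * f.den - a * b' = 1 := by
    rw [hbu, ha']; linear_combination huv
  have hcop' : IsCoprime a' b' := ⟨f.den, -a, by linarith⟩
  lift b' to ℕ using hb'1.le with B hB
  have hcop : Nat.Coprime a'.natAbs B := by
    have := Int.isCoprime_iff_gcd_eq_one.1 hcop'
    simpa [Int.gcd] using this
  set g : ℚ := (a' : ℚ) / ((B : ℤ) : ℚ) with hg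
  have hgn : g.num = a' := Rat.num_div_eq_of_coprime hb'1 (by simpa using hcop)
  have hgd : (g.den : ℤ) = B := Rat.den_div_eq_of_coprime hb'1 (by simpa using hcop)
  have ha'0 : 0 ≤ a' := by
    by_contra! hneg
    have : 0 ≤ a * (B : ℤ) := by positivity
    nlinarith
  have ha'B : a' ≤ B := by
    by_contra! hlt
    nlinarith
  have hgF : g ∈ fareySet Q := by
    refine ⟨?_, ?_, ?_⟩
    · rw [← Rat.num_nonneg, hgn]; exact ha'0
    · rw [Rat.le_iff, hgn, hgd]; simpa using ha'B
    · omega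
  refine ⟨g, ⟨hf, hgF, ?_, ?_⟩, ?_, ?_⟩
  · rw [Rat.lt_iff, hgn, hgd]; linarith
  · rintro h ⟨-, -, hhQ⟩ ⟨h1, h2⟩
    rw [Rat.lt_iff] at h1 h2
    rw [hgn, hgd] at h2
    -- A fraction strictly in between has a denominator that combines `b` and `b'` with positive
    -- integer coefficients, hence at least `b + b' > Q`.
    have h3 : (h.den : ℤ) = f.den * (a' * h.den - h.num * B) + B * (h.num * f.den - a * h.den) := by
      linear_combination (-(h.den : ℤ)) * hdet
    have h4 : (f.den : ℤ) * 1 ≤ f.den * (a' * h.den - h.num * B) :=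
      mul_le_mul_of_nonneg_left (by linarith) hb0.le
    have h5 : (B : ℤ) * 1 ≤ B * (h.num * f.den - a * h.den) :=
      mul_le_mul_of_nonneg_left (by linarith) hb'1.le
    have h6 : (h.den : ℤ) ≤ Q := by exact_mod_cast hhQ
    omega
  · omega
  · rw [hgn, hgd]; exact hdet

theorem IsNextFarey.lt_one {Q : ℕ} {f g : ℚ} (h : IsNextFarey Q f g) : f < 1 :=
  h.2.2.1.trans_le h.2.1.2.1

theorem IsNextFarey.lt_add {Q : ℕ} {f g : ℚ} (h : IsNextFarey Q f g) : Q < f.den + g.den := by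
  obtain ⟨g', h1, h2, -⟩ := exists_isNextFarey h.1 h.lt_one
  rwa [h.eq h1]

theorem IsNextFarey.det {Q : ℕ} {f g : ℚ} (h : IsNextFarey Q f g) :
    g.num * f.den - f.num * g.den = 1 := by
  obtain ⟨g', h1, -, h2⟩ := exists_isNextFarey h.1 h.lt_one
  rwa [h.eq h1]

theorem IsNextFarey.isGenerator {Q : ℕ} {f g : ℚ} (h : IsNextFarey Q f g) :
    IsGenerator Q f.den g.den :=
  ⟨by exact_mod_cast h.1.2.2, by exact_mod_cast h.2.1.2.2, by exact_mod_cast h.lt_add,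
    ⟨g.num, -f.num, by linarith [h.det]⟩⟩

theorem IsGenerator.pos {Q a b : ℤ} (h : IsGenerator Q a b) : 0 < a ∧ 0 < b :=
  ⟨by linarith [h.1, h.2.1, h.2.2.1], by linarith [h.1, h.2.1, h.2.2.1]⟩

theorem eq_of_modEq_of_lt {a x y l : ℤ} (h : a ∣ x - y) (hx : l < x) (hx' : x ≤ l + a)
    (hy : l < y) (hy' : y ≤ l + a) : x = y := by
  have := Int.eq_zero_of_abs_lt_dvd h (by rw [abs_lt]; constructor <;> linarith)
  linarith

/-- The numerator over `a` is recovered as the inverse of `-b` modulo `a`; the successor of this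
fraction must then have denominator `b`. -/
theorem exists_isNextFarey_of_isGenerator {Q : ℕ} {a b : ℤ} (h : IsGenerator Q a b) :
    ∃ f g, IsNextFarey Q f g ∧ (f.den : ℤ) = a ∧ (g.den : ℤ) = b := by
  obtain ⟨ha, hb⟩ := h.pos
  obtain ⟨haQ, hbQ, hab, z, w, hzw⟩ := h
  set u : ℤ := (-w) % a with hu
  have hu0 : 0 ≤ u := Int.emod_nonneg _ ha.ne'
  have hu1 : u < a := Int.emod_lt_of_pos _ ha
  have hdm := Int.emod_add_mul_ediv (-w) a
  rw [← hu] at hdm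
  set t := (-w) / a
  have hub : u * b = a * (z - t * b) - 1 := by
    have : u = -w - a * t := by linarith
    rw [this]; linear_combination (-1) * hzw
  have hcop : IsCoprime u a := ⟨-b, z - t * b, by linarith⟩
  lift a to ℕ using ha.le
  have hcop' : Nat.Coprime u.natAbs a := by
    have := Int.isCoprime_iff_gcd_eq_one.1 hcop
    simpa [Int.gcd] using this
  set f : ℚ := (u : ℚ) / ((a : ℤ) : ℚ) with hf
  have hfn : f.num = u := Rat.num_div_eq_of_coprime ha (by simpa using hcop')
  have hfd : (f.den : ℤ) = a := Rat.den_div_eq_of_coprime ha (by simpa using hcop')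
  have hf1 : f < 1 := by rw [Rat.lt_iff, hfn, hfd]; simpa using hu1
  have hfF : f ∈ fareySet Q := by
    refine ⟨?_, hf1.le, ?_⟩
    · rw [← Rat.num_nonneg, hfn]; exact hu0
    · omega
  obtain ⟨g, hg, hQ, hdet⟩ := exists_isNextFarey hfF hf1
  refine ⟨f, g, hg, hfd, ?_⟩
  have hgQ : (g.den : ℤ) ≤ Q := by exact_mod_cast hg.2.1.2.2
  -- Both `g.den` and `b` lie in `(Q - a, Q]`, which meets each class modulo `a` once.
  refine eq_of_modEq_of_lt (a := a) (l := Q - a) ?_ (by omega) (by omega) (by omega) (by omega)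
  refine hcop.symm.dvd_of_dvd_mul_left ⟨g.num - (z - t * b), ?_⟩
  rw [hfn, hfd] at hdet
  linear_combination (-1) * hdet - hub

theorem IsNextFarey.eq_of_den_eq {Q : ℕ} {f g f' g' : ℚ} (h : IsNextFarey Q f g)
    (h' : IsNextFarey Q f' g') (h1 : f.den = f'.den) (h2 : g.den = g'.den) : f = f' := by
  have hn : f.num = f'.num := by
    have hlt := Rat.lt_iff f 1 |>.1 h.lt_one
    have hlt' := Rat.lt_iff f' 1 |>.1 h'.lt_one
    have h0 := Rat.num_nonneg.2 h.1.1
    have h0' := Rat.num_nonneg.2 h'.1.1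
    simp only [Rat.num_one, Rat.den_one, Nat.cast_one, mul_one, one_mul] at hlt hlt'
    -- Both numerators lie in `[0, f.den)`, since `f` and `f'` are less than `1`.
    refine eq_of_modEq_of_lt (a := f.den) (l := -1) ?_ (by omega) (by omega) (by omega) (by omega)
    have hd := h.det
    have hd' := h'.det
    rw [← h1, ← h2] at hd'
    have hcop : IsCoprime (f.den : ℤ) g.den := h.isGenerator.2.2.2
    refine hcop.dvd_of_dvd_mul_left ⟨g.num - g'.num, ?_⟩
    linear_combination hd' - hd
  exact Rat.ext hn h1

/-- The two determinant relations make `g.den` divide `f.den + h.den`, and `Q - h.den` is a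
remainder in `[0, g.den)`; so the quotient is the integer part in the recursion. -/
theorem IsNextFarey.den_eq {Q : ℕ} {f g h : ℚ} (h1 : IsNextFarey Q f g) (h2 : IsNextFarey Q g h) :
    (h.den : ℤ) = (((f.den : ℤ) + Q) / g.den) * g.den - f.den := by
  have hd1 := h1.det
  have hd2 := h2.det
  have hg : (0 : ℤ) < g.den := by exact_mod_cast g.den_pos
  obtain ⟨t, ht⟩ : (g.den : ℤ) ∣ f.den + h.den := by
    refine (Rat.isCoprime_num_den g).symm.dvd_of_dvd_mul_left ⟨f.num + h.num, ?_⟩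
    linear_combination hd1 - hd2
  have hQ := h2.lt_add
  have hhQ := h2.2.1.2.2
  have hdiv : ((f.den : ℤ) + Q) / g.den = t := by
    have : (f.den : ℤ) + Q = (Q - h.den) + t * g.den := by linarith
    rw [this, Int.add_mul_ediv_right _ _ hg.ne', Int.ediv_eq_zero_of_lt (by omega) (by omega),
      zero_add]
  rw [hdiv]; linarith

theorem den_eq_genDenom {Q m : ℕ} {E : ℕ → ℚ} (h : ∀ i < m, IsNextFarey Q (E i) (E (i + 1))) :
    ∀ i ≤ m, ((E i).den : ℤ) = genDenom Q (E 0).den (E 1).den i := by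
  intro i
  induction i using Nat.twoStepInduction with
  | zero => intro _; rfl
  | one => intro _; rfl
  | more i ih1 ih2 =>
    intro hi
    rw [genDenom, ← ih1 (by omega), ← ih2 (by omega)]
    exact (h i (by omega)).den_eq (h (i + 1) (by omega))

/-! ### Enumeration of the Farey sequence and counting of tuples -/

/-- `E` enumerates the Farey sequence of order `Q` in ascending order. -/
structure IsEnumeration (Q : ℕ) (E : ℕ → ℚ) : Prop where
  mem : ∀ t < (fareySet Q).ncard, E t ∈ fareySet Q
  lt : ∀ s t, s < t → t < (fareySet Q).ncard → E s < E t
  surj : ∀ f ∈ fareySet Q, ∃ t < (fareySet Q).ncard, E t = f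

theorem exists_isEnumeration (Q : ℕ) : ∃ E : ℕ → ℚ, IsEnumeration Q E := by
  set F := (finite_fareySet Q).toFinset with hF
  have hcard : F.card = (fareySet Q).ncard := (Set.ncard_eq_toFinset_card _ _).symm
  set e := F.orderIsoOfFin hcard
  refine ⟨fun t => if h : t < (fareySet Q).ncard then e ⟨t, h⟩ else 0, ?_, ?_, ?_⟩
  · intro t ht
    simp only [ht, dif_pos]
    exact (finite_fareySet Q).mem_toFinset.1 (e ⟨t, ht⟩).2
  · intro s t hst ht
    simp only [ht, hst.trans ht, dif_pos]
    exact e.strictMono (show (⟨s, _⟩ : Fin _) < ⟨t, ht⟩ from hst)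
  · intro f hf
    refine ⟨e.symm ⟨f, (finite_fareySet Q).mem_toFinset.2 hf⟩, Fin.is_lt _, ?_⟩
    simp

/-- The generators with the prescribed residues of the generated denominators. -/
def generatorsOfParity (Q r : ℕ) (c : Fin r → ℕ) (d : ℕ) : Set (ℤ × ℤ) :=
  {p | IsGenerator Q p.1 p.2 ∧ ∀ j : Fin r, genDenom Q p.1 p.2 j ≡ (c j : ℤ) [ZMOD (d : ℤ)]}


namespace IsEnumeration

variable {Q : ℕ} {E : ℕ → ℚ}

theorem index_lt (hE : IsEnumeration Q E) {s t : ℕ} (hs : s < (fareySet Q).ncard)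
    (h : E s < E t) : s < t := by
  by_contra! hle
  rcases hle.eq_or_lt with rfl | hlt
  · exact lt_irrefl _ h
  · exact lt_asymm h (hE.lt t s hlt hs)

theorem index_eq (hE : IsEnumeration Q E) {s t : ℕ} (hs : s < (fareySet Q).ncard)
    (ht : t < (fareySet Q).ncard) (h : E s = E t) : s = t := by
  rcases lt_trichotomy s t with hlt | heq | hlt
  · exact absurd h (hE.lt s t hlt ht).ne
  · exact heq
  · exact absurd h (hE.lt t s hlt hs).ne'

theorem isNextFarey (hE : IsEnumeration Q E) {t : ℕ} (ht : t + 1 < (fareySet Q).ncard) :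
    IsNextFarey Q (E t) (E (t + 1)) := by
  refine ⟨hE.mem t (by omega), hE.mem _ ht, hE.lt _ _ (Nat.lt_succ_self t) ht, ?_⟩
  rintro h hh ⟨h1, h2⟩
  obtain ⟨s, hs, rfl⟩ := hE.surj h hh
  have := hE.index_lt (by omega) h1
  have := hE.index_lt hs h2
  omega

theorem exists_of_isNextFarey (hE : IsEnumeration Q E) {f g : ℚ} (h : IsNextFarey Q f g) :
    ∃ t, t + 1 < (fareySet Q).ncard ∧ E t = f ∧ E (t + 1) = g := by
  obtain ⟨t, ht, rfl⟩ := hE.surj f h.1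
  obtain ⟨s, hs, rfl⟩ := hE.surj g h.2.1
  have hlt := hE.index_lt ht h.2.2.1
  have ht1 : t + 1 < (fareySet Q).ncard := by omega
  exact ⟨t, ht1, rfl, (hE.isNextFarey ht1).eq h⟩

theorem den_eq_genDenom (hE : IsEnumeration Q E) {t j : ℕ} (h : t + j < (fareySet Q).ncard) :
    ((E (t + j)).den : ℤ) = genDenom Q (E t).den (E (t + 1)).den j :=
  FareyResidues.den_eq_genDenom (E := fun i => E (t + i)) (m := j)
    (fun _ _ => hE.isNextFarey (by omega)) j le_rfl

theorem eq_of_isConsecutiveFarey (hE : IsEnumeration Q E) {r : ℕ} {f : Fin r → ℚ}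
    (hf : IsConsecutiveFarey Q r f) (hr : 0 < r) :
    ∃ t, t + r ≤ (fareySet Q).ncard ∧ ∀ i : Fin r, f i = E (t + i) := by
  obtain ⟨h1, h2, h3⟩ := hf
  obtain ⟨t, ht, htf⟩ := hE.surj _ (h1 ⟨0, hr⟩)
  have key : ∀ i (hi : i < r), t + i < (fareySet Q).ncard ∧ f ⟨i, hi⟩ = E (t + i) := by
    intro i
    induction i with
    | zero => intro hi; exact ⟨ht, htf.symm⟩
    | succ i ih =>
      intro hi
      obtain ⟨h4, h5⟩ := ih (by omega)
      have hn : IsNextFarey Q (f ⟨i, by omega⟩) (f ⟨i + 1, hi⟩) :=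
        ⟨h1 _, h1 _, h2 (Fin.mk_lt_mk.2 (Nat.lt_succ_self i)), h3 _ _ rfl⟩
      obtain ⟨s, hs, hs1, hs2⟩ := hE.exists_of_isNextFarey hn
      have : s = t + i := hE.index_eq (by omega) h4 (hs1.trans h5)
      subst this
      exact ⟨hs, hs2.symm⟩
  refine ⟨t, ?_, fun i => (key i i.2).2⟩
  have := (key (r - 1) (by omega)).1
  omega

theorem isConsecutiveFarey (hE : IsEnumeration Q E) {r t : ℕ}
    (h : t + r ≤ (fareySet Q).ncard) : IsConsecutiveFarey Q r fun i => E (t + i) := by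
  refine ⟨fun i => hE.mem _ (by omega), fun i j hij => hE.lt _ _ ?_ (by omega), ?_⟩
  · have : (i : ℕ) < j := hij
    omega
  · intro i j hij
    have : t + (j : ℕ) = t + i + 1 := by omega
    simp only [this]
    exact (hE.isNextFarey (by omega)).2.2.2

/-- The pairs of neighbouring denominators are the generators. -/
theorem generators_eq_image (hE : IsEnumeration Q E) {C : ℤ × ℤ → Prop} :
    {p : ℤ × ℤ | IsGenerator Q p.1 p.2 ∧ C p} =
      (fun t => (((E t).den : ℤ), ((E (t + 1)).den : ℤ))) ''
        {t | t + 1 < (fareySet Q).ncard ∧ C ((E t).den, (E (t + 1)).den)} := by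
  ext ⟨a, b⟩
  simp only [mem_ofPred_eq, mem_image]
  constructor
  · rintro ⟨h1, h2⟩
    obtain ⟨f, g, hfg, rfl, rfl⟩ := exists_isNextFarey_of_isGenerator h1
    obtain ⟨t, ht, rfl, rfl⟩ := hE.exists_of_isNextFarey hfg
    exact ⟨t, ⟨ht, h2⟩, rfl⟩
  · rintro ⟨t, ⟨ht, h2⟩, h3⟩
    obtain ⟨rfl, rfl⟩ := Prod.mk.inj h3
    exact ⟨(hE.isNextFarey ht).isGenerator, h2⟩

theorem injOn_den (hE : IsEnumeration Q E) :
    Set.InjOn (fun t => (((E t).den : ℤ), ((E (t + 1)).den : ℤ)))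
      {t | t + 1 < (fareySet Q).ncard} := by
  intro s hs t ht hst
  simp only [Prod.mk.injEq, Nat.cast_inj] at hst
  simp only [mem_ofPred_eq] at hs ht
  exact hE.index_eq (by omega) (by omega)
    ((hE.isNextFarey hs).eq_of_den_eq (hE.isNextFarey ht) hst.1 hst.2)

theorem ncard_generators (hE : IsEnumeration Q E) {C : ℤ × ℤ → Prop} :
    {p : ℤ × ℤ | IsGenerator Q p.1 p.2 ∧ C p}.ncard =
      {t | t + 1 < (fareySet Q).ncard ∧ C ((E t).den, (E (t + 1)).den)}.ncard := by
  rw [hE.generators_eq_image]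
  exact (hE.injOn_den.mono fun t ht => ht.1).ncard_image

theorem tuplesOfParity_eq_image (hE : IsEnumeration Q E) {r : ℕ} (hr : 2 ≤ r) (c : Fin r → ℕ)
    (d : ℕ) : tuplesOfParity Q r c d = (fun t (j : Fin r) => (E (t + j)).den) ''
      {t | t + r ≤ (fareySet Q).ncard ∧ ∀ j : Fin r,
        genDenom Q (E t).den (E (t + 1)).den j ≡ (c j : ℤ) [ZMOD (d : ℤ)]} := by
  ext q
  simp only [tuplesOfParity, consecutiveDenominators, mem_ofPred_eq, mem_image]
  constructor
  · rintro ⟨⟨f, hf, hq⟩, hc⟩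
    obtain ⟨t, ht, hft⟩ := hE.eq_of_isConsecutiveFarey hf (by omega)
    refine ⟨t, ⟨ht, fun j => ?_⟩, ?_⟩
    · rw [← hE.den_eq_genDenom (by omega), ← hft, ← hq]
      exact Int.natCast_modEq_iff.2 (hc j)
    · ext j; rw [hq, hft]
  · rintro ⟨t, ⟨ht, hc⟩, rfl⟩
    refine ⟨⟨_, hE.isConsecutiveFarey ht, fun i => rfl⟩, fun j => ?_⟩
    have := hc j
    rw [← hE.den_eq_genDenom (by omega)] at this
    exact Int.natCast_modEq_iff.1 this

/-- The first two denominators already determine the position in the sequence, so no tuple arises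
from two positions. -/
theorem ncard_tuplesOfParity (hE : IsEnumeration Q E) {r : ℕ} (hr : 2 ≤ r) (c : Fin r → ℕ)
    (d : ℕ) : (tuplesOfParity Q r c d).ncard =
      {t | t + r ≤ (fareySet Q).ncard ∧ ∀ j : Fin r,
        genDenom Q (E t).den (E (t + 1)).den j ≡ (c j : ℤ) [ZMOD (d : ℤ)]}.ncard := by
  rw [hE.tuplesOfParity_eq_image hr]
  refine Set.InjOn.ncard_image fun s hs t ht hst => ?_
  have h0 := congrFun hst ⟨0, by omega⟩
  have h1 := congrFun hst ⟨1, by omega⟩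
  simp only [add_zero] at h0 h1
  have hs1 := hs.1
  have ht1 := ht.1
  refine hE.injOn_den (x₁ := s) (x₂ := t) ?_ ?_ (by simp only [h0, h1])
  · simp only [mem_ofPred_eq]; omega
  · simp only [mem_ofPred_eq]; omega

end IsEnumeration

theorem zero_mem_fareySet {Q : ℕ} (hQ : 1 ≤ Q) : (0 : ℚ) ∈ fareySet Q :=
  ⟨le_rfl, zero_le_one, by simpa using hQ⟩

/-- Every fraction except the last has a successor, and the resulting pairs of denominators are
distinct. -/
theorem ncard_fareySet {Q : ℕ} (hQ : 1 ≤ Q) :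
    (fareySet Q).ncard = {p : ℤ × ℤ | IsGenerator Q p.1 p.2}.ncard + 1 := by
  obtain ⟨E, hE⟩ := exists_isEnumeration Q
  have h := hE.ncard_generators (C := fun _ => True)
  simp only [and_true] at h
  have h2 : {t | t + 1 < (fareySet Q).ncard} = Set.Iio ((fareySet Q).ncard - 1) := by
    ext t; simp only [mem_ofPred_eq, mem_Iio]; omega
  have h3 : (Set.Iio ((fareySet Q).ncard - 1)).ncard = (fareySet Q).ncard - 1 := by
    rw [← Finset.coe_Iio, Set.ncard_coe_finset, Nat.card_Iio]
  have h4 : 0 < (fareySet Q).ncard :=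
    (Set.ncard_pos (finite_fareySet Q)).2 ⟨0, zero_mem_fareySet hQ⟩
  rw [h, h2, h3]
  omega

/-- A generator fails to start a full tuple only if its position is among the last `r`. -/
theorem ncard_tuplesOfParity_le {Q r : ℕ} (hr : 2 ≤ r) (c : Fin r → ℕ) (d : ℕ) :
    (tuplesOfParity Q r c d).ncard ≤ (generatorsOfParity Q r c d).ncard ∧
      (generatorsOfParity Q r c d).ncard ≤ (tuplesOfParity Q r c d).ncard + r := by
  obtain ⟨E, hE⟩ := exists_isEnumeration Q
  rw [hE.ncard_tuplesOfParity hr, generatorsOfParity, hE.ncard_generators]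
  have hfin : {t | t + 1 < (fareySet Q).ncard ∧ ∀ j : Fin r,
        genDenom Q (E t).den (E (t + 1)).den j ≡ (c j : ℤ) [ZMOD (d : ℤ)]}.Finite :=
    (Set.finite_Iio (fareySet Q).ncard).subset fun t ht => by
      have := ht.1
      simp only [mem_Iio]; omega
  have hsub : {t | t + r ≤ (fareySet Q).ncard ∧ ∀ j : Fin r,
        genDenom Q (E t).den (E (t + 1)).den j ≡ (c j : ℤ) [ZMOD (d : ℤ)]} ⊆
      {t | t + 1 < (fareySet Q).ncard ∧ ∀ j : Fin r,
        genDenom Q (E t).den (E (t + 1)).den j ≡ (c j : ℤ) [ZMOD (d : ℤ)]} := fun t ht =>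
    ⟨by have := ht.1; omega, ht.2⟩
  refine ⟨Set.ncard_le_ncard hsub hfin, ?_⟩
  have hsub2 : {t | t + 1 < (fareySet Q).ncard ∧ ∀ j : Fin r,
        genDenom Q (E t).den (E (t + 1)).den j ≡ (c j : ℤ) [ZMOD (d : ℤ)]} ⊆
      {t | t + r ≤ (fareySet Q).ncard ∧ ∀ j : Fin r,
        genDenom Q (E t).den (E (t + 1)).den j ≡ (c j : ℤ) [ZMOD (d : ℤ)]} ∪
      (Finset.Ico ((fareySet Q).ncard - r) (fareySet Q).ncard : Finset ℕ) := by
    intro t ht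
    by_cases h : t + r ≤ (fareySet Q).ncard
    · exact Or.inl ⟨h, ht.2⟩
    · refine Or.inr ?_
      have := ht.1
      simp only [Finset.coe_Ico, mem_Ico]; omega
  refine (Set.ncard_le_ncard hsub2 ((hfin.subset hsub).union (Finset.finite_toSet _))).trans ?_
  refine (Set.ncard_union_le _ _).trans ?_
  rw [Set.ncard_coe_finset, Nat.card_Ico]
  omega

/-! ### From generators to points of the scaled triangle -/

/-- The lattice point `p`, scaled down by `Q`. -/
noncomputable def scaledPoint (Q : ℤ) (p : ℤ × ℤ) : ℝ × ℝ := ((p.1 : ℝ) / Q, (p.2 : ℝ) / Q)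

theorem isGenerator_iff {Q : ℤ} (hQ : 1 ≤ Q) {p : ℤ × ℤ} :
    IsGenerator Q p.1 p.2 ↔ IsCoprime p.1 p.2 ∧ scaledPoint Q p ∈ fareyTriangle := by
  have hQ' : (0 : ℝ) < Q := by exact_mod_cast hQ
  simp only [IsGenerator, scaledPoint, fareyTriangle, mem_ofPred_eq, div_le_one hQ', ← add_div,
    one_lt_div hQ']
  norm_cast
  tauto

theorem floor_div_eq {Q a b : ℤ} (hQ : 1 ≤ Q) (hb : 0 < (b : ℝ) / Q) :
    ⌊(1 + (a : ℝ) / Q) / ((b : ℝ) / Q)⌋ = (a + Q) / b := by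
  have hQ' : (0 : ℝ) < Q := by exact_mod_cast hQ
  have hb' : (0 : ℝ) < b := by
    have := mul_pos hb hQ'
    rwa [div_mul_cancel₀ _ hQ'.ne'] at this
  have hb0 : 0 < b := by exact_mod_cast hb'
  rw [Int.floor_eq_iff, le_div_iff₀ hb, div_lt_iff₀ hb]
  have h1 : (((a + Q) / b : ℤ) : ℝ) * b ≤ a + Q := by exact_mod_cast Int.ediv_mul_le (a + Q) hb0.ne'
  have h2 : (a : ℝ) + Q < ((((a + Q) / b : ℤ) : ℝ) + 1) * b := by
    exact_mod_cast Int.lt_ediv_add_one_mul_self (a + Q) hb0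
  constructor
  · rw [← mul_div_assoc, div_le_iff₀ hQ']
    have : (1 + (a : ℝ) / Q) * Q = a + Q := by field_simp; ring
    linarith
  · rw [← mul_div_assoc, lt_div_iff₀ hQ']
    have : (1 + (a : ℝ) / Q) * Q = a + Q := by field_simp; ring
    linarith

theorem fareyL_scaledPoint {Q : ℤ} (hQ : 1 ≤ Q) {p : ℤ × ℤ}
    (hp : scaledPoint Q p ∈ fareyTriangle) (j : ℕ) :
    fareyL (scaledPoint Q p).1 (scaledPoint Q p).2 j = (genDenom Q p.1 p.2 j : ℝ) / Q := by
  induction j using Nat.twoStepInduction with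
  | zero => rfl
  | one => rfl
  | more j ih1 ih2 =>
    have hpos : 0 < fareyL (scaledPoint Q p).1 (scaledPoint Q p).2 (j + 1) := fareyL_succ_pos hp j
    simp only [fareyL, genDenom]
    rw [ih2] at hpos
    rw [ih1, ih2, floor_div_eq hQ hpos]
    push_cast
    ring

theorem fareyIndex_scaledPoint {Q : ℤ} (hQ : 1 ≤ Q) {p : ℤ × ℤ}
    (hp : scaledPoint Q p ∈ fareyTriangle) (j : ℕ) :
    fareyIndex (scaledPoint Q p).1 (scaledPoint Q p).2 j = genIndex Q p.1 p.2 j := by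
  have hpos : 0 < fareyL (scaledPoint Q p).1 (scaledPoint Q p).2 (j + 1) := fareyL_succ_pos hp j
  rw [fareyL_scaledPoint hQ hp] at hpos
  rw [fareyIndex, fareyL_scaledPoint hQ hp, fareyL_scaledPoint hQ hp, floor_div_eq hQ hpos, genIndex]

theorem scaledPoint_mem_polygon_iff {Q : ℤ} (hQ : 1 ≤ Q) {p : ℤ × ℤ} {s : ℕ} {k : Fin s → ℕ} :
    IsCoprime p.1 p.2 ∧ scaledPoint Q p ∈ polygon k ↔
      IsGenerator Q p.1 p.2 ∧ ∀ j : Fin s, genIndex Q p.1 p.2 j = (k j : ℤ) := by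
  rw [isGenerator_iff hQ]
  constructor
  · rintro ⟨h1, h2⟩
    exact ⟨⟨h1, h2.1⟩, fun j => by rw [← fareyIndex_scaledPoint hQ h2.1]; exact h2.2 j⟩
  · rintro ⟨⟨h1, h2⟩, h3⟩
    exact ⟨h1, h2, fun j => by rw [fareyIndex_scaledPoint hQ h2]; exact h3 j⟩

/-- The indices are the only coefficients of the recursion, so equal indices propagate congruences.
This turns the condition on `r` residues into a condition on the first two, within each polygon. -/
theorem genDenom_modEq {Q Q' : ℤ} {p p' : ℤ × ℤ} {d : ℤ} {s : ℕ}
    (h : ∀ j < s, genIndex Q p.1 p.2 j = genIndex Q' p'.1 p'.2 j) (h1 : p.1 ≡ p'.1 [ZMOD d])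
    (h2 : p.2 ≡ p'.2 [ZMOD d]) :
    ∀ j < s + 2, genDenom Q p.1 p.2 j ≡ genDenom Q' p'.1 p'.2 j [ZMOD d] := by
  intro j
  induction j using Nat.twoStepInduction with
  | zero => intro _; exact h1
  | one => intro _; exact h2
  | more j ih1 ih2 =>
    intro hj
    have h3 := h j (by omega)
    rw [genIndex, genIndex] at h3
    rw [genDenom, genDenom, h3]
    exact ((ih2 (by omega)).mul_left _).sub (ih1 (by omega))

/-! ### Counting coprime points in scaled polygons -/

/-- The coprime lattice points congruent to `c` modulo `d` in the plane set `S` scaled by `Q`. -/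
def coprimePoints (Q : ℕ) (d : ℕ) (c : ℤ × ℤ) (S : Set (ℝ × ℝ)) : Set (ℤ × ℤ) :=
  {p | IsCoprime p.1 p.2 ∧ p.1 ≡ c.1 [ZMOD d] ∧ p.2 ≡ c.2 [ZMOD d] ∧ scaledPoint Q p ∈ S}

theorem coprimePoints_congr {Q d : ℕ} {c c' : ℤ × ℤ} {S : Set (ℝ × ℝ)}
    (h1 : c.1 ≡ c'.1 [ZMOD d]) (h2 : c.2 ≡ c'.2 [ZMOD d]) :
    coprimePoints Q d c S = coprimePoints Q d c' S := by
  ext p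
  simp only [coprimePoints, mem_ofPred_eq]
  exact ⟨fun ⟨a, b, e, f⟩ => ⟨a, b.trans h1, e.trans h2, f⟩,
    fun ⟨a, b, e, f⟩ => ⟨a, b.trans h1.symm, e.trans h2.symm, f⟩⟩

theorem abs_ncard_coprimePoints_sub_le {Q : ℕ} (hQ : 1 ≤ Q) {S : Set (ℝ × ℝ)} (hc : Convex ℝ S)
    (hm : MeasurableSet S) (hS : S ⊆ fareyTriangle) {Y : ℝ} (hY0 : 0 ≤ Y) (hY : ∀ p ∈ S, p.2 ≤ Y)
    {d : ℕ} (hd : d ≠ 0) {c : ℤ × ℤ} (hcop : IsCoprime c.1 c.2) (P : Finset ℕ)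
    (hP : ∀ (b : ℕ) (x : ℝ), (x, (b : ℝ) / Q) ∈ S → b ∈ P) :
    |((coprimePoints Q d c S).ncard : ℝ) - coprimeDensity d * ((Q : ℝ) ^ 2 * area S)| ≤
      ∑ b ∈ P, (b.divisors.card : ℝ) + Q * Y * (3 + Real.log (1 + Q * Y)) := by
  have hQ' : (0 : ℝ) < Q := by exact_mod_cast hQ
  set R : Set (ℝ × ℝ) := (fun z : ℝ × ℝ => (Q : ℝ)⁻¹ • z) ⁻¹' S with hR
  have hRmem : ∀ x y : ℝ, (x, y) ∈ R ↔ (x / Q, y / Q) ∈ S := by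
    intro x y
    simp only [hR, mem_preimage, Prod.smul_mk, smul_eq_mul, div_eq_inv_mul]
  have harea : area R = (Q : ℝ) ^ 2 * area S := by
    rw [hR, area, Measure.addHaar_preimage_smul _ (inv_ne_zero hQ'.ne')]
    have : Module.finrank ℝ (ℝ × ℝ) = 2 := by simp
    rw [this, ENNReal.toReal_mul, ENNReal.toReal_ofReal (abs_nonneg _), inv_pow, inv_inv,
      abs_of_pos (by positivity), area]
  have hset : coprimePoints Q d c S = {p : ℤ × ℤ | IsCoprime p.1 p.2 ∧ p.1 ≡ c.1 [ZMOD d] ∧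
      p.2 ≡ c.2 [ZMOD d] ∧ ((p.1 : ℝ), (p.2 : ℝ)) ∈ R} := by
    ext p
    simp only [coprimePoints, scaledPoint, mem_ofPred_eq, hRmem, Int.cast_natCast]
  rw [hset, ← harea]
  refine abs_ncard_coprime_sub_area_le (R := R) ?_ ?_ (by positivity) ?_ (by positivity) ?_ hd _ _ ?_
    P ?_
  · exact hc.smul_preimage _
  · exact (measurable_const_smul _) hm
  · intro x x' y h h'
    rw [hRmem] at h h'
    have h1 := (hS h).2.2
    have h2 := (hS h').1
    have h3 := hY _ h
    simp only at h1 h2 h3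
    -- Horizontal sections of the triangle at height `y` lie in `(1 - y, 1]`, so a height bound is
    -- also a width bound.
    have h4 : (x' - x) / Q ≤ Y := by rw [sub_div]; linarith
    rwa [div_le_iff₀ hQ', mul_comm] at h4
  · rintro ⟨x, y⟩ h
    rw [hRmem] at h
    have h1 := fareyTriangle_snd_pos (hS h)
    have h2 := hY _ h
    simp only at h1 h2 ⊢
    constructor
    · have := mul_pos h1 hQ'
      rwa [div_mul_cancel₀ _ hQ'.ne'] at this
    · rwa [div_le_iff₀ hQ', mul_comm] at h2
  · intro m h1 h2 _
    have := hcop.isUnit_of_dvd' h1 h2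
    rw [Int.isUnit_iff_natAbs_eq] at this
    simpa using this
  · intro b x h
    rw [hRmem] at h
    exact hP b _ h

theorem sum_card_divisors_le (Q : ℕ) :
    ∑ b ∈ Finset.Icc 1 Q, (b.divisors.card : ℝ) ≤ Q * (1 + Real.log (1 + Q)) := by
  have h1 : ∑ b ∈ Finset.Icc 1 Q, b.divisors.card =
      ∑ m ∈ Finset.Icc 1 Q, ((Finset.Icc 1 Q).filter (m ∣ ·)).card := by
    simp_rw [Finset.card_filter]
    rw [Finset.sum_comm]
    refine Finset.sum_congr rfl fun b hb => ?_
    rw [← Finset.card_filter]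
    congr 1
    ext m
    rw [Finset.mem_Icc] at hb
    rw [Nat.mem_divisors, Finset.mem_filter, Finset.mem_Icc]
    constructor
    · rintro ⟨h, -⟩
      exact ⟨⟨Nat.pos_of_dvd_of_pos h hb.1, (Nat.le_of_dvd hb.1 h).trans hb.2⟩, h⟩
    · rintro ⟨-, h⟩
      exact ⟨h, by omega⟩
  have h2 : ∀ m ∈ Finset.Icc 1 Q, (((Finset.Icc 1 Q).filter (m ∣ ·)).card : ℝ) ≤
      Q * (m : ℝ)⁻¹ := by
    intro m _
    have : Finset.Icc 1 Q = Finset.Ioc 0 Q := by ext; simp [Nat.succ_le_iff]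
    rw [this, Nat.Ioc_filter_dvd_card_eq_div, ← div_eq_mul_inv]
    exact Nat.cast_div_le
  have h3 : ∑ b ∈ Finset.Icc 1 Q, (b.divisors.card : ℝ) =
      ∑ m ∈ Finset.Icc 1 Q, (((Finset.Icc 1 Q).filter (m ∣ ·)).card : ℝ) := by exact_mod_cast h1
  rw [h3]
  refine (Finset.sum_le_sum h2).trans ?_
  rw [← Finset.mul_sum]
  gcongr
  exact sum_Icc_inv_le_one_add_log le_rfl (Nat.cast_nonneg Q)

theorem abs_ncard_coprimePoints_sub_le_of_subset {Q : ℕ} (hQ : 1 ≤ Q) {S : Set (ℝ × ℝ)}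
    (hc : Convex ℝ S) (hm : MeasurableSet S) (hS : S ⊆ fareyTriangle)
    {d : ℕ} (hd : d ≠ 0) {c : ℤ × ℤ} (hcop : IsCoprime c.1 c.2) :
    |((coprimePoints Q d c S).ncard : ℝ) - coprimeDensity d * ((Q : ℝ) ^ 2 * area S)| ≤
      2 * (Q * (3 + Real.log (1 + 2 * Q))) := by
  have hQ' : (0 : ℝ) < Q := by exact_mod_cast hQ
  have h := abs_ncard_coprimePoints_sub_le hQ hc hm hS zero_le_one (fun p hp => (hS hp).2.1) hd hcop
    (Finset.Icc 1 Q) (fun b x hb => by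
      have h1 := (hS hb).2.1
      have h2 := fareyTriangle_snd_pos (hS hb)
      simp only at h1 h2
      rw [div_le_one hQ'] at h1
      have h3 : (0 : ℝ) < b := by
        have := mul_pos h2 hQ'
        rwa [div_mul_cancel₀ _ hQ'.ne'] at this
      rw [Finset.mem_Icc]
      exact ⟨by exact_mod_cast h3, by exact_mod_cast h1⟩)
  have h2 := sum_card_divisors_le Q
  have h3 : Real.log (1 + Q) ≤ Real.log (1 + 2 * Q) := Real.log_le_log (by positivity) (by linarith)
  rw [mul_one] at h
  nlinarith

/-! ### Counting in the peak polygons -/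

/-- A bound for the number of points of the peak polygons. -/
noncomputable def peakError (Q k : ℕ) : ℝ :=
  if k ≤ 2 * Q then
    ∑ b ∈ (Finset.Icc 1 Q).filter (fun b => k * b ≤ 2 * Q ∧ 2 * Q < (k + 2) * b),
      (b.divisors.card : ℝ) + 2 * (Q : ℝ) * (3 + Real.log (1 + 2 * Q)) * (k : ℝ)⁻¹
  else 4 * Q * ((k : ℝ) ^ 2)⁻¹

theorem peakError_nonneg (Q k : ℕ) : 0 ≤ peakError Q k := by
  have : 0 ≤ Real.log (1 + 2 * (Q : ℝ)) := Real.log_nonneg (by linarith [(Nat.cast_nonneg Q : (0:ℝ) ≤ Q)])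
  rw [peakError]
  split_ifs <;> positivity

theorem coprimeDensity_nonneg (d : ℕ) : 0 ≤ coprimeDensity d := by
  rw [coprimeDensity]
  have : 0 ≤ ∏ p ∈ d.primeFactors, (1 - 1 / (p : ℝ) ^ 2)⁻¹ := by
    refine Finset.prod_nonneg fun p hp => inv_nonneg.2 ?_
    have : (1 : ℝ) ≤ p := by exact_mod_cast (Nat.prime_of_mem_primeFactors hp).one_le
    rw [sub_nonneg, div_le_one (by positivity)]
    exact one_le_pow₀ this
  positivity

/-- Each factor is at most `p`, since `1 - p⁻² ≥ 3 / 4 ≥ p⁻¹`, and the product of the primes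
dividing `d` is at most `d`. -/
theorem prod_inv_le {d : ℕ} (hd : d ≠ 0) :
    (∏ p ∈ d.primeFactors, (1 - 1 / (p : ℝ) ^ 2)⁻¹) / (d : ℝ) ^ 2 ≤ 1 := by
  have hd1 : (1 : ℝ) ≤ d := by exact_mod_cast Nat.one_le_iff_ne_zero.2 hd
  rw [div_le_one (by positivity)]
  have h1 : ∏ p ∈ d.primeFactors, (1 - 1 / (p : ℝ) ^ 2)⁻¹ ≤ ∏ p ∈ d.primeFactors, (p : ℝ) := by
    refine Finset.prod_le_prod (fun p hp => ?_) fun p hp => ?_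
    · have : (1 : ℝ) ≤ p := by exact_mod_cast (Nat.prime_of_mem_primeFactors hp).one_le
      rw [inv_nonneg, sub_nonneg, div_le_one (by positivity)]
      exact one_le_pow₀ this
    · have : (2 : ℝ) ≤ p := by exact_mod_cast (Nat.prime_of_mem_primeFactors hp).two_le
      have h4 : 1 / (p : ℝ) ^ 2 ≤ 1 / 4 := by
        apply one_div_le_one_div_of_le <;> nlinarith
      refine inv_le_of_inv_le₀ (by positivity) ?_
      have : (p : ℝ)⁻¹ ≤ 2⁻¹ := inv_anti₀ (by norm_num) this
      linarith
  have h2 : ∏ p ∈ d.primeFactors, (p : ℝ) ≤ d := by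
    rw [← Nat.cast_prod, Nat.cast_le]
    exact Nat.le_of_dvd (Nat.pos_of_ne_zero hd) (Nat.prod_primeFactors_dvd d)
  nlinarith

theorem coprimeDensity_le_one {d : ℕ} (hd : d ≠ 0) : coprimeDensity d ≤ 1 := by
  have h1 := prod_inv_le hd
  have h2 : 6 / Real.pi ^ 2 ≤ 1 := by
    rw [div_le_one (by positivity)]
    nlinarith [Real.pi_gt_three]
  rw [coprimeDensity, mul_div_assoc]
  calc _ ≤ 6 / Real.pi ^ 2 * 1 := by gcongr
    _ ≤ 1 := by linarith

/-- For `k ≤ 2 Q` the rows `b` satisfy `2 Q / (k + 2) < b ≤ 2 Q / k` and the width is at most `2 Q /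
k`. For `k > 2 Q` no lattice point is left, and the expected number itself is at most `8 Q² / k³ ≤ 4
Q / k²`. -/
theorem abs_ncard_coprimePoints_firstPolygon_sub_le {Q : ℕ} (hQ : 1 ≤ Q) {k : ℕ} (hk : 0 < k)
    {d : ℕ} (hd : d ≠ 0) {c : ℤ × ℤ} (hcop : IsCoprime c.1 c.2) :
    |((coprimePoints Q d c (firstPolygon k)).ncard : ℝ) -
      coprimeDensity d * ((Q : ℝ) ^ 2 * area (firstPolygon k))| ≤ peakError Q k := by
  have hQ' : (0 : ℝ) < Q := by exact_mod_cast hQ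
  have hk' : (0 : ℝ) < k := by exact_mod_cast hk
  have hbd : ∀ (b : ℤ) (x : ℝ), (x, (b : ℝ) / Q) ∈ firstPolygon k →
      0 < b ∧ b ≤ Q ∧ k * b ≤ 2 * Q ∧ 2 * Q < (k + 2) * b := by
    intro b x h
    have h1 := firstPolygon_bounds h
    have h2 := fareyTriangle_snd_pos h.1
    have h3 := h.1.2.1
    simp only at h1 h2 h3
    rw [← mul_div_assoc, ← mul_div_assoc, div_le_iff₀ hQ', lt_div_iff₀ hQ'] at h1
    rw [div_le_one hQ'] at h3
    have h4 : (0 : ℝ) < b := by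
      have := mul_pos h2 hQ'
      rwa [div_mul_cancel₀ _ hQ'.ne'] at this
    exact ⟨by exact_mod_cast h4, by exact_mod_cast h3, by exact_mod_cast h1.1,
      by exact_mod_cast h1.2⟩
  rw [peakError]
  split_ifs with hkQ
  · have hkQ' : (k : ℝ) ≤ 2 * Q := by exact_mod_cast hkQ
    refine (abs_ncard_coprimePoints_sub_le hQ (convex_polygon _) (measurableSet_polygon _)
      (fun p hp => hp.1) (Y := 2 / k) (by positivity) (fun p hp => ?_) hd hcop
      ((Finset.Icc 1 Q).filter (fun b => k * b ≤ 2 * Q ∧ 2 * Q < (k + 2) * b))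
      (fun b x h => ?_)).trans ?_
    · rw [le_div_iff₀ hk', mul_comm]
      exact (firstPolygon_bounds hp).1
    · have := hbd b x (by simpa using h)
      rw [Finset.mem_filter, Finset.mem_Icc]
      refine ⟨⟨?_, ?_⟩, ?_, ?_⟩
      · exact_mod_cast this.1
      · exact_mod_cast this.2.1
      · exact_mod_cast this.2.2.1
      · exact_mod_cast this.2.2.2
    · refine add_le_add le_rfl ?_
      have h1 : Real.log (1 + Q * (2 / k)) ≤ Real.log (1 + 2 * Q) := by
        refine Real.log_le_log (by positivity) ?_
        have : Q * (2 / (k : ℝ)) ≤ Q * 2 := by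
          gcongr
          exact div_le_self (by norm_num) (by exact_mod_cast hk)
        linarith
      calc Q * (2 / (k : ℝ)) * (3 + Real.log (1 + Q * (2 / k)))
          ≤ Q * (2 / (k : ℝ)) * (3 + Real.log (1 + 2 * Q)) := by gcongr
        _ = _ := by rw [div_eq_mul_inv]; ring
  · have hempty : coprimePoints Q d c (firstPolygon k) = ∅ := by
      rw [Set.eq_empty_iff_forall_notMem]
      intro p hp
      have h := hbd p.2 _ (by simpa [scaledPoint] using hp.2.2.2)
      have h1 : (k : ℤ) * 1 ≤ k * p.2 := mul_le_mul_of_nonneg_left h.1 (Nat.cast_nonneg k)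
      omega
    rw [hempty, Set.ncard_empty, Nat.cast_zero, zero_sub, abs_neg]
    have ha0 : 0 ≤ area (firstPolygon k) := ENNReal.toReal_nonneg
    rw [abs_of_nonneg (mul_nonneg (coprimeDensity_nonneg d) (by positivity))]
    have h2 : 2 * (Q : ℝ) ≤ k := by
      have : 2 * Q ≤ k := by omega
      exact_mod_cast this
    calc _ ≤ 1 * ((Q : ℝ) ^ 2 * (8 / (k : ℝ) ^ 3)) := by
          gcongr
          · exact coprimeDensity_le_one hd
          · exact area_firstPolygon_le hk
      _ = 4 * Q * ((k : ℝ) ^ 2)⁻¹ * (2 * Q / k) := by field_simp; ring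
      _ ≤ 4 * Q * ((k : ℝ) ^ 2)⁻¹ * 1 := by
          gcongr
          rwa [div_le_one hk']
      _ = _ := mul_one _

/-- The divisor sums total `O(Q log Q)` because each row belongs to at most two values of `k`; the
harmonic sum over `k ≤ 2 Q` supplies the second logarithm; the tail `k > 2 Q` is bounded. -/
theorem sum_peakError_le {Q : ℕ} (hQ : 1 ≤ Q) (B : Finset ℕ) (hB : ∀ k ∈ B, 0 < k) :
    ∑ k ∈ B, peakError Q k ≤ 8 * (Q * (3 + Real.log (1 + 2 * Q)) ^ 2) := by
  have hQ' : (1 : ℝ) ≤ Q := by exact_mod_cast hQ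
  have hlog : 0 ≤ Real.log (1 + 2 * (Q : ℝ)) := Real.log_nonneg (by linarith)
  set L := Real.log (1 + 2 * (Q : ℝ)) with hL
  have hsplit := Finset.sum_filter_add_sum_filter_not B (fun k => k ≤ 2 * Q) (peakError Q)
  set P : ℕ → Finset ℕ := fun k =>
    (Finset.Icc 1 Q).filter (fun b => k * b ≤ 2 * Q ∧ 2 * Q < (k + 2) * b) with hP
  have h1 : ∑ k ∈ B.filter (· ≤ 2 * Q), peakError Q k =
      ∑ k ∈ B.filter (· ≤ 2 * Q), ∑ b ∈ P k, (b.divisors.card : ℝ) +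
        2 * (Q : ℝ) * (3 + L) * ∑ k ∈ B.filter (· ≤ 2 * Q), (k : ℝ)⁻¹ := by
    rw [Finset.mul_sum, ← Finset.sum_add_distrib]
    refine Finset.sum_congr rfl fun k hk => ?_
    rw [peakError, if_pos (Finset.mem_filter.1 hk).2]
  have h2 : ∑ k ∈ B.filter (fun k => ¬ k ≤ 2 * Q), peakError Q k =
      4 * Q * ∑ k ∈ B.filter (fun k => ¬ k ≤ 2 * Q), ((k : ℝ) ^ 2)⁻¹ := by
    rw [Finset.mul_sum]
    refine Finset.sum_congr rfl fun k hk => ?_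
    rw [peakError, if_neg (Finset.mem_filter.1 hk).2]
  have h3 : ∑ k ∈ B.filter (· ≤ 2 * Q), (k : ℝ)⁻¹ ≤ 1 + L := by
    refine le_trans ?_ (sum_Icc_inv_le_one_add_log (M := 2 * Q) (H := 2 * Q) (by push_cast; rfl)
      (by positivity))
    refine Finset.sum_le_sum_of_subset_of_nonneg (fun k hk => ?_) fun _ _ _ => by positivity
    rw [Finset.mem_filter] at hk
    exact Finset.mem_Icc.2 ⟨hB k hk.1, hk.2⟩
  have h4 : ∑ k ∈ B.filter (fun k => ¬ k ≤ 2 * Q), ((k : ℝ) ^ 2)⁻¹ ≤ 2 / (2 * Q + 1) := by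
    have := sum_Ioo_inv_sq_le (α := ℝ) (2 * Q) (B.sup id + 1)
    push_cast at this
    refine le_trans (Finset.sum_le_sum_of_subset_of_nonneg (fun k hk => ?_)
      fun _ _ _ => by positivity) this
    rw [Finset.mem_filter] at hk
    have := Finset.le_sup (f := id) hk.1
    simp only [id] at this
    exact Finset.mem_Ioo.2 ⟨by omega, by omega⟩
  have h4' : 4 * (Q : ℝ) * (2 / (2 * Q + 1)) ≤ 4 := by
    rw [← mul_div_assoc, div_le_iff₀ (by positivity)]; linarith
  have h5 : ∑ k ∈ B.filter (· ≤ 2 * Q), ∑ b ∈ P k, (b.divisors.card : ℝ) ≤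
      2 * ∑ b ∈ Finset.Icc 1 Q, (b.divisors.card : ℝ) := by
    have : ∀ k, ∑ b ∈ P k, (b.divisors.card : ℝ) = ∑ b ∈ Finset.Icc 1 Q,
        if k * b ≤ 2 * Q ∧ 2 * Q < (k + 2) * b then (b.divisors.card : ℝ) else 0 := by
      intro k; rw [hP, Finset.sum_filter]
    simp_rw [this]
    rw [Finset.sum_comm, Finset.mul_sum]
    refine Finset.sum_le_sum fun b hb => ?_
    have hb0 : 0 < b := (Finset.mem_Icc.1 hb).1
    rw [← Finset.sum_filter, Finset.sum_const, nsmul_eq_mul]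
    gcongr
    -- For given `b`, the conditions say `2 Q / b - 2 < k ≤ 2 Q / b`.
    have hsub : (B.filter (· ≤ 2 * Q)).filter
        (fun k => k * b ≤ 2 * Q ∧ 2 * Q < (k + 2) * b) ⊆ {2 * Q / b - 1, 2 * Q / b} := by
      intro k hk
      have hk' := (Finset.mem_filter.1 hk).2
      have h6 : k ≤ 2 * Q / b := (Nat.le_div_iff_mul_le hb0).2 hk'.1
      have h7 : 2 * Q / b < k + 2 := (Nat.div_lt_iff_lt_mul hb0).2 hk'.2
      simp only [Finset.mem_insert, Finset.mem_singleton]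
      omega
    exact_mod_cast (Finset.card_le_card hsub).trans Finset.card_le_two
  have h6 := sum_card_divisors_le Q
  have h7 : Real.log (1 + Q) ≤ L := Real.log_le_log (by positivity) (by linarith)
  have h8 : ∑ b ∈ Finset.Icc 1 Q, (b.divisors.card : ℝ) ≤ Q * (1 + L) :=
    h6.trans (by gcongr)
  have h9 : 2 * (Q : ℝ) * (3 + L) * ∑ k ∈ B.filter (· ≤ 2 * Q), (k : ℝ)⁻¹ ≤
      2 * (Q : ℝ) * (3 + L) * (1 + L) := by gcongr
  have h10 : 4 * (Q : ℝ) * ∑ k ∈ B.filter (fun k => ¬ k ≤ 2 * Q), ((k : ℝ) ^ 2)⁻¹ ≤ 4 :=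
    le_trans (by gcongr) h4'
  rw [← hsplit, h1, h2]
  have h11 : (1 : ℝ) ≤ Q * (1 + L) := by nlinarith
  have h12 : 0 ≤ Q * L ^ 2 := by positivity
  have h13 : 0 ≤ Q * L := by positivity
  nlinarith

theorem exists_pullBack {A : Type*} [CommRing A] (j : ℕ) (p : A × A) : ∃ q, pullBack j q = p := by
  rcases eq_or_ne j 0 with rfl | hj
  · exact ⟨p, by simp [pullBack]⟩
  · refine ⟨(p.1 + j * (p.2 - p.1), p.2 - p.1), ?_⟩
    rw [pullBack, if_neg hj]
    ext <;> simp only <;> ring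

theorem pullBack_injective {A : Type*} [CommRing A] (j : ℕ) :
    Function.Injective (pullBack j : A × A → A × A) := by
  intro p q h
  rcases eq_or_ne j 0 with rfl | hj
  · simpa [pullBack] using h
  · rw [pullBack, pullBack, if_neg hj, if_neg hj] at h
    obtain ⟨h1, h2⟩ := Prod.mk.inj h
    have h3 : p.2 = q.2 := by linear_combination h2 - h1
    refine Prod.ext ?_ h3
    linear_combination h1 + j * h3

theorem isCoprime_pullBack {j : ℕ} {p : ℤ × ℤ} :
    IsCoprime (pullBack j p).1 (pullBack j p).2 ↔ IsCoprime p.1 p.2 := by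
  rcases eq_or_ne j 0 with rfl | hj
  · simp [pullBack]
  · rw [pullBack, if_neg hj]
    constructor
    · rintro ⟨u, v, h⟩
      exact ⟨u + v, -(u * j) - v * (j - 1), by linear_combination h⟩
    · rintro ⟨u, v, h⟩
      refine ⟨-(u * (j - 1)) - v, u * j + v, ?_⟩
      simp only
      linear_combination h

theorem pullBack_modEq_iff {j : ℕ} {d : ℤ} {p q : ℤ × ℤ} :
    ((pullBack j p).1 ≡ (pullBack j q).1 [ZMOD d] ∧
      (pullBack j p).2 ≡ (pullBack j q).2 [ZMOD d]) ↔
      (p.1 ≡ q.1 [ZMOD d] ∧ p.2 ≡ q.2 [ZMOD d]) := by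
  rcases eq_or_ne j 0 with rfl | hj
  · simp [pullBack]
  · rw [pullBack, pullBack, if_neg hj, if_neg hj]
    simp only [Int.modEq_iff_dvd]
    constructor
    · rintro ⟨⟨a, ha⟩, ⟨b, hb⟩⟩
      exact ⟨⟨a + j * (b - a), by linear_combination ha + j * (hb - ha)⟩,
        ⟨b - a, by linear_combination hb - ha⟩⟩
    · rintro ⟨⟨a, ha⟩, ⟨b, hb⟩⟩
      exact ⟨⟨a - j * b, by linear_combination ha - j * hb⟩,
        ⟨a - (j - 1) * b, by linear_combination ha - (j - 1) * hb⟩⟩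

theorem scaledPoint_pullBack (Q : ℤ) (j : ℕ) (p : ℤ × ℤ) :
    scaledPoint Q (pullBack j p) = pullBack j (scaledPoint Q p) := by
  rcases eq_or_ne j 0 with rfl | hj
  · simp [pullBack]
  · rw [pullBack, pullBack, if_neg hj, if_neg hj, scaledPoint, scaledPoint]
    ext <;> simp only <;> push_cast <;> ring

/-- The map is unimodular over `ℤ`: it permutes the lattice points, preserves coprimality, permutes
the residue classes modulo `d` and commutes with scaling. -/
theorem ncard_coprimePoints_pullBack (Q d j : ℕ) (e : ℤ × ℤ) (S : Set (ℝ × ℝ)) :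
    (coprimePoints Q d (pullBack j e) (pullBack j '' S)).ncard = (coprimePoints Q d e S).ncard := by
  rw [← Set.ncard_image_of_injective (coprimePoints Q d e S) (pullBack_injective (A := ℤ) j)]
  congr 1
  ext p
  obtain ⟨q, rfl⟩ := exists_pullBack j p
  rw [(pullBack_injective j).mem_set_image]
  simp only [coprimePoints, mem_ofPred_eq]
  rw [scaledPoint_pullBack, (pullBack_injective j).mem_set_image, isCoprime_pullBack,
    ← and_assoc (a := (_ ≡ _ [ZMOD _])), pullBack_modEq_iff, and_assoc]

theorem abs_ncard_coprimePoints_peakVector_sub_le {Q : ℕ} (hQ : 1 ≤ Q) {s j k : ℕ} (hj : j < s)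
    (hk : 4 * s + 13 ≤ k) {d : ℕ} (hd : d ≠ 0) {c : ℤ × ℤ} (hcop : IsCoprime c.1 c.2) :
    |((coprimePoints Q d c (polygon (peakVector s j k))).ncard : ℝ) -
      coprimeDensity d * ((Q : ℝ) ^ 2 * area (polygon (peakVector s j k)))| ≤ peakError Q k := by
  obtain ⟨e, rfl⟩ := exists_pullBack j c
  rw [polygon_peakVector hj hk, area_pullBack_image, ncard_coprimePoints_pullBack]
  exact abs_ncard_coprimePoints_firstPolygon_sub_le hQ (by omega) hd (isCoprime_pullBack.1 hcop)

/-! ### Summability of the areas -/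

theorem area_nonneg (S : Set (ℝ × ℝ)) : 0 ≤ area S := ENNReal.toReal_nonneg

theorem volume_fareyTriangle : volume fareyTriangle = ENNReal.ofReal (1 / 2) := by
  rw [Measure.volume_eq_prod, Measure.prod_apply measurableSet_fareyTriangle]
  have h : ∀ x : ℝ, volume (Prod.mk x ⁻¹' fareyTriangle) =
      (Ioc (0 : ℝ) 1).indicator (fun x => ENNReal.ofReal x) x := by
    intro x
    by_cases hx : x ∈ Ioc (0 : ℝ) 1
    · have : Prod.mk x ⁻¹' fareyTriangle = Ioc (1 - x) 1 := by
        ext y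
        simp only [fareyTriangle, mem_preimage, mem_ofPred_eq, mem_Ioc]
        constructor
        · rintro ⟨-, h2, h3⟩; exact ⟨by linarith, h2⟩
        · rintro ⟨h2, h3⟩; exact ⟨hx.2, h3, by linarith⟩
      rw [this, indicator_of_mem hx, Real.volume_Ioc, sub_sub_cancel]
    · have : Prod.mk x ⁻¹' fareyTriangle = ∅ := by
        ext y
        simp only [fareyTriangle, mem_preimage, mem_ofPred_eq, mem_empty_iff_false, iff_false]
        rintro ⟨h1, h2, h3⟩
        exact hx ⟨by linarith, h1⟩
      rw [this, indicator_of_notMem hx, measure_empty]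
  simp_rw [h]
  rw [lintegral_indicator measurableSet_Ioc, ← ofReal_integral_eq_lintegral_ofReal,
    ← intervalIntegral.integral_of_le zero_le_one]
  · simp
  · exact (continuous_id.integrableOn_Icc (a := (0 : ℝ)) (b := 1)).mono_set Ioc_subset_Icc_self
  · filter_upwards [ae_restrict_mem measurableSet_Ioc] with x hx using hx.1.le

theorem area_fareyTriangle : area fareyTriangle = 1 / 2 := by
  rw [area, volume_fareyTriangle, ENNReal.toReal_ofReal (by norm_num)]

theorem sum_area_polygon_le {s : ℕ} (A : Finset (Fin s → ℕ)) :
    ∑ k ∈ A, area (polygon k) ≤ 1 / 2 := by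
  have hdisj : Set.PairwiseDisjoint (A : Set (Fin s → ℕ)) polygon := by
    intro k _ k' _ hkk
    rw [Function.onFun, Set.disjoint_left]
    intro p hp hp'
    apply hkk
    ext i
    have := (hp.2 i).symm.trans (hp'.2 i)
    exact_mod_cast this
  have hfin : volume fareyTriangle ≠ ⊤ := by rw [volume_fareyTriangle]; exact ENNReal.ofReal_ne_top
  have h1 : volume (⋃ k ∈ A, polygon k) = ∑ k ∈ A, volume (polygon k) :=
    measure_biUnion_finset hdisj fun k _ => measurableSet_polygon k
  have h2 : ∑ k ∈ A, area (polygon k) = (volume (⋃ k ∈ A, polygon k)).toReal := by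
    rw [h1, ENNReal.toReal_sum fun k _ => ne_top_of_le_ne_top hfin (measure_mono fun p hp => hp.1)]
    rfl
  rw [h2, ← area_fareyTriangle]
  exact ENNReal.toReal_mono hfin (measure_mono (Set.iUnion₂_subset fun k _ p hp => hp.1))

theorem sum_subtype_area_le {s : ℕ} {K : Set (Fin s → ℕ)} (A : Finset K) :
    ∑ k ∈ A, area (polygon (k : Fin s → ℕ)) ≤ 1 / 2 := by
  have h := sum_area_polygon_le (A.map (Function.Embedding.subtype _))
  rwa [Finset.sum_map] at h

theorem summable_area {s : ℕ} (K : Set (Fin s → ℕ)) :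
    Summable fun k : K => area (polygon (k : Fin s → ℕ)) :=
  summable_of_sum_le (fun _ => area_nonneg _) sum_subtype_area_le

theorem tsum_area_le {s : ℕ} (K : Set (Fin s → ℕ)) :
    ∑' k : K, area (polygon (k : Fin s → ℕ)) ≤ 1 / 2 :=
  Real.tsum_le_of_sum_le (fun _ => area_nonneg _) sum_subtype_area_le

/-! ### The total discrepancy -/

/-- The difference between the number of coprime points of a scaled polygon and its expected
value. -/
noncomputable def discrepancy (Q d : ℕ) (c : ℤ × ℤ) {s : ℕ} (k : Fin s → ℕ) : ℝ :=
  ((coprimePoints Q d c (polygon k)).ncard : ℝ) -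
    coprimeDensity d * ((Q : ℝ) ^ 2 * area (polygon k))

/-- A vector without large components gets the general convex bound. Any other is a peak vector, by
nonemptiness of its polygon, and a single term of the sum over `j` already bounds it; the sum is
convenient for exchanging summations. -/
theorem abs_discrepancy_le {Q : ℕ} (hQ : 1 ≤ Q) {s d : ℕ} (hd : d ≠ 0) {c : ℤ × ℤ}
    (hcop : IsCoprime c.1 c.2) {k : Fin s → ℕ} (hne : (polygon k).Nonempty) :
    |discrepancy Q d c k| ≤
      (if ∀ j, k j < 4 * s + 13 then 2 * (Q * (3 + Real.log (1 + 2 * Q))) else 0) +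
        ∑ j, if 4 * s + 13 ≤ k j then peakError Q (k j) else 0 := by
  by_cases h : ∀ j, k j < 4 * s + 13
  · rw [if_pos h]
    have h0 : ∑ j, (if 4 * s + 13 ≤ k j then peakError Q (k j) else 0) = 0 :=
      Finset.sum_eq_zero fun j _ => if_neg (by have := h j; omega)
    rw [h0, add_zero]
    exact abs_ncard_coprimePoints_sub_le_of_subset hQ (convex_polygon k) (measurableSet_polygon k)
      (fun p hp => hp.1) hd hcop
  · rw [if_neg h, zero_add]
    push Not at h
    obtain ⟨j, hj⟩ := h
    obtain ⟨p, hp⟩ := hne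
    have hk := eq_peakVector hj hp
    have h1 := abs_ncard_coprimePoints_peakVector_sub_le hQ j.2 hj hd hcop
    rw [← hk] at h1
    refine h1.trans ?_
    have h2 := Finset.single_le_sum (f := fun j => if 4 * s + 13 ≤ k j then peakError Q (k j) else 0)
      (fun i _ => by split_ifs; exacts [peakError_nonneg _ _, le_rfl]) (Finset.mem_univ j)
    simpa only [if_pos hj] using h2

/-- The total discrepancy over a family of admissible vectors. -/
theorem sum_abs_discrepancy_le {Q : ℕ} (hQ : 1 ≤ Q) {s d : ℕ} (hd : d ≠ 0) {c : ℤ × ℤ}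
    (A : Finset (Fin s → ℕ)) (hA : ∀ k ∈ A, (polygon k).Nonempty)
    (hc : A.Nonempty → ∃ e : ℤ × ℤ, IsCoprime e.1 e.2 ∧ c.1 ≡ e.1 [ZMOD d] ∧ c.2 ≡ e.2 [ZMOD d]) :
    ∑ k ∈ A, |discrepancy Q d c k| ≤
      (4 * s + 13 : ℝ) ^ s * (2 * (Q * (3 + Real.log (1 + 2 * Q)))) +
        s * (8 * (Q * (3 + Real.log (1 + 2 * Q)) ^ 2)) := by
  have hlog : 0 ≤ Real.log (1 + 2 * (Q : ℝ)) :=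
    Real.log_nonneg (by linarith [(Nat.cast_nonneg Q : (0:ℝ) ≤ Q)])
  rcases A.eq_empty_or_nonempty with rfl | hne
  · rw [Finset.sum_empty]; positivity
  obtain ⟨e, he, he1, he2⟩ := hc hne
  have hce : ∀ k : Fin s → ℕ, discrepancy Q d c k = discrepancy Q d e k := fun k => by
    rw [discrepancy, discrepancy, coprimePoints_congr he1 he2]
  simp_rw [hce]
  refine (Finset.sum_le_sum fun k hk => abs_discrepancy_le hQ hd he (hA k hk)).trans ?_
  rw [Finset.sum_add_distrib]
  refine add_le_add ?_ ?_
  · rw [← Finset.sum_filter, Finset.sum_const, nsmul_eq_mul]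
    refine mul_le_mul_of_nonneg_right ?_ (by positivity)
    have hsub : A.filter (fun k => ∀ j, k j < 4 * s + 13) ⊆
        Fintype.piFinset fun _ : Fin s => Finset.range (4 * s + 13) := by
      intro k hk
      simpa [Fintype.mem_piFinset] using (Finset.mem_filter.1 hk).2
    have := Finset.card_le_card hsub
    rw [Fintype.card_piFinset_const, Finset.card_range] at this
    exact_mod_cast this
  · rw [Finset.sum_comm]
    have hcard : (s : ℝ) * (8 * (Q * (3 + Real.log (1 + 2 * Q)) ^ 2)) =
        ∑ _j : Fin s, 8 * (Q * (3 + Real.log (1 + 2 * (Q : ℝ))) ^ 2) := by simp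
    rw [hcard]
    refine Finset.sum_le_sum fun j _ => ?_
    rw [← Finset.sum_filter]
    -- For a fixed position `j`, a peak vector is determined by its component there, so each `k` is
    -- charged at most once per position.
    have hinj : Set.InjOn (fun k : Fin s → ℕ => k j) (A.filter fun k => 4 * s + 13 ≤ k j) := by
      intro k hk k' hk' hkk
      rw [Finset.mem_coe, Finset.mem_filter] at hk hk'
      obtain ⟨p, hp⟩ := hA k hk.1
      obtain ⟨p', hp'⟩ := hA k' hk'.1
      rw [eq_peakVector hk.2 hp, eq_peakVector hk'.2 hp']
      simp only at hkk
      rw [hkk]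
    rw [← Finset.sum_image (f := peakError Q) hinj]
    refine sum_peakError_le hQ _ fun k hk => ?_
    obtain ⟨k', hk', rfl⟩ := Finset.mem_image.1 hk
    have := (Finset.mem_filter.1 hk').2
    omega

theorem admissibleOfParity_witness {r : ℕ} (hr : 2 ≤ r) {c : Fin r → ℕ} {d : ℕ}
    {k : Fin (r - 2) → ℕ} (hk : k ∈ admissibleOfParity r c d) :
    (polygon k).Nonempty ∧ ∃ e : ℤ × ℤ, IsCoprime e.1 e.2 ∧
      (c ⟨0, by omega⟩ : ℤ) ≡ e.1 [ZMOD d] ∧ (c ⟨1, by omega⟩ : ℤ) ≡ e.2 [ZMOD d] := by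
  obtain ⟨-, Q, q₁, q₂, hQ, hg, hi, hc⟩ := hk
  have h := (scaledPoint_mem_polygon_iff hQ (p := (q₁, q₂)) (k := k)).2 ⟨hg, hi⟩
  exact ⟨⟨_, h.2⟩, (q₁, q₂), h.1, (hc ⟨0, by omega⟩).symm, (hc ⟨1, by omega⟩).symm⟩

/-- The witness of admissibility has the same indices and the same first two residues as `p`, so its
remaining residues, which are `c`, are those of `p`. -/
theorem mem_coprimePoints_polygon_iff {Q r : ℕ} (hQ : 1 ≤ Q) (hr : 2 ≤ r) {c : Fin r → ℕ} {d : ℕ}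
    {k : Fin (r - 2) → ℕ} (hk : k ∈ admissibleOfParity r c d) {p : ℤ × ℤ} :
    p ∈ coprimePoints Q d (c ⟨0, by omega⟩, c ⟨1, by omega⟩) (polygon k) ↔
      p ∈ generatorsOfParity Q r c d ∧
        ∀ j : Fin (r - 2), genIndex Q p.1 p.2 j = (k j : ℤ) := by
  have hQ' : (1 : ℤ) ≤ Q := by exact_mod_cast hQ
  have h := scaledPoint_mem_polygon_iff hQ' (p := p) (k := k)
  simp only [coprimePoints, generatorsOfParity, mem_ofPred_eq]
  constructor
  · rintro ⟨h1, h2, h3, h4⟩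
    obtain ⟨hg, hi⟩ := h.1 ⟨h1, h4⟩
    refine ⟨⟨hg, fun j => ?_⟩, hi⟩
    obtain ⟨-, Q', q₁, q₂, hQ', hg', hi', hc'⟩ := hk
    refine (genDenom_modEq (p := p) (p' := (q₁, q₂)) (Q' := Q') (s := r - 2) (fun i his => ?_)
      ?_ ?_ j (by omega)).trans (hc' j)
    · exact (hi ⟨i, his⟩).trans (hi' ⟨i, his⟩).symm
    · exact h2.trans (hc' ⟨0, by omega⟩).symm
    · exact h3.trans (hc' ⟨1, by omega⟩).symm
  · rintro ⟨⟨hg, hc⟩, hi⟩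
    obtain ⟨h1, h4⟩ := h.2 ⟨hg, hi⟩
    exact ⟨h1, hc ⟨0, by omega⟩, hc ⟨1, by omega⟩, h4⟩

theorem finite_generatorsOfParity (Q r : ℕ) (c : Fin r → ℕ) (d : ℕ) :
    (generatorsOfParity Q r c d).Finite := by
  refine ((Set.finite_Icc (1 : ℤ) Q).prod (Set.finite_Icc (1 : ℤ) Q)).subset ?_
  rintro ⟨a, b⟩ ⟨hg, -⟩
  obtain ⟨h1, h2⟩ := hg.pos
  exact ⟨⟨h1, hg.1⟩, ⟨h2, hg.2.1⟩⟩

theorem abs_ncard_generatorsOfParity_sub_le {Q r : ℕ} (hQ : 1 ≤ Q) (hr : 2 ≤ r) (c : Fin r → ℕ)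
    {d : ℕ} (hd : d ≠ 0) :
    |((generatorsOfParity Q r c d).ncard : ℝ) - coprimeDensity d * ((Q : ℝ) ^ 2 *
      ∑' k : admissibleOfParity r c d, area (polygon (k : Fin (r - 2) → ℕ)))| ≤
      (4 * (r - 2 : ℕ) + 13 : ℝ) ^ (r - 2) * (2 * (Q * (3 + Real.log (1 + 2 * Q)))) +
        (r - 2 : ℕ) * (8 * (Q * (3 + Real.log (1 + 2 * Q)) ^ 2)) := by
  classical
  have hQ' : (1 : ℤ) ≤ Q := by exact_mod_cast hQ
  set G := (finite_generatorsOfParity Q r c d).toFinset with hG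
  set c' : ℤ × ℤ := (c ⟨0, by omega⟩, c ⟨1, by omega⟩) with hc'
  have hidx : ∀ p ∈ generatorsOfParity Q r c d, ∀ j : Fin (r - 2),
      genIndex Q p.1 p.2 j = ((genIndex Q p.1 p.2 j).toNat : ℤ) := by
    intro p hp j
    have hT := ((isGenerator_iff hQ').1 hp.1).2
    have : 0 < fareyIndex (scaledPoint Q p).1 (scaledPoint Q p).2 j := fareyIndex_pos hT j
    rw [fareyIndex_scaledPoint hQ' hT] at this
    exact (Int.toNat_of_nonneg this.le).symm
  have hadm : ∀ p ∈ generatorsOfParity Q r c d,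
      (fun j : Fin (r - 2) => (genIndex Q p.1 p.2 j).toNat) ∈ admissibleOfParity r c d := by
    intro p hp
    exact ⟨⟨Q, p.1, p.2, hQ', hp.1, hidx p hp⟩, Q, p.1, p.2, hQ', hp.1, hidx p hp, hp.2⟩
  set v : ℤ × ℤ → Fin (r - 2) → ℕ := fun p j => (genIndex Q p.1 p.2 j).toNat with hv
  -- The finitely many vectors attained at order `Q`. Over any finite family containing them the
  -- point counts add up exactly, and the error bound does not depend on the family, so the limit
  -- over finite families yields the full series.
  set A₀ : Finset (admissibleOfParity r c d) :=
    G.attach.image fun p : {x // x ∈ G} => ⟨v p, hadm p ((finite_generatorsOfParity Q r c d).mem_toFinset.1 p.2)⟩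
    with hA₀
  have hlim := ((((summable_area (admissibleOfParity r c d)).hasSum.mul_left
    ((Q : ℝ) ^ 2)).mul_left (coprimeDensity d)).const_sub
      ((generatorsOfParity Q r c d).ncard : ℝ)).abs
  refine le_of_tendsto hlim ?_
  filter_upwards [Filter.eventually_ge_atTop A₀] with A hA
  set B : Finset (Fin (r - 2) → ℕ) := A.map (Function.Embedding.subtype _) with hB
  have hBmem : ∀ k ∈ B, k ∈ admissibleOfParity r c d := by
    intro k hk
    obtain ⟨a, -, rfl⟩ := Finset.mem_map.1 hk
    exact a.2
  have hcount : ((generatorsOfParity Q r c d).ncard : ℝ) =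
      ∑ k ∈ B, ((coprimePoints Q d c' (polygon k)).ncard : ℝ) := by
    rw [Set.ncard_eq_toFinset_card _ (finite_generatorsOfParity Q r c d)]
    rw [Finset.card_eq_sum_card_fiberwise (f := v) (t := B)]
    · push_cast
      refine Finset.sum_congr rfl fun k hk => ?_
      congr 1
      rw [← Set.ncard_coe_finset]
      congr 1
      ext p
      rw [hc', mem_coprimePoints_polygon_iff hQ hr (hBmem k hk)]
      simp only [Finset.coe_filter, Finite.mem_toFinset, mem_ofPred_eq]
      refine and_congr_right fun hp => ?_
      rw [funext_iff]
      refine forall_congr' fun j => ?_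
      rw [hidx p hp j, Nat.cast_inj]
    · intro p hp
      have hp' : p ∈ generatorsOfParity Q r c d :=
        (finite_generatorsOfParity Q r c d).mem_toFinset.1 hp
      have : (⟨v p, hadm p hp'⟩ : admissibleOfParity r c d) ∈ A₀ :=
        Finset.mem_image.2 ⟨⟨p, hp⟩, Finset.mem_attach _ _, rfl⟩
      exact Finset.mem_coe.2 (Finset.mem_map.2 ⟨_, hA this, rfl⟩)
  have harea : ∑ k ∈ A, coprimeDensity d * ((Q : ℝ) ^ 2 * area (polygon (k : Fin (r - 2) → ℕ))) =
      ∑ k ∈ B, coprimeDensity d * ((Q : ℝ) ^ 2 * area (polygon k)) := by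
    rw [hB, Finset.sum_map]; rfl
  rw [harea, hcount, ← Finset.sum_sub_distrib]
  refine (Finset.abs_sum_le_sum_abs _ _).trans ?_
  exact sum_abs_discrepancy_le hQ hd B (fun k hk => (admissibleOfParity_witness hr (hBmem k hk)).1)
    (fun ⟨k, hk⟩ => (admissibleOfParity_witness hr (hBmem k hk)).2)

/-! ### Assembly of the estimate -/

/-- The case `d = 1` for the whole triangle: density `6 / π²` times area `1 / 2`. -/
theorem abs_ncard_generators_sub_le {Q : ℕ} (hQ : 1 ≤ Q) :
    |({p : ℤ × ℤ | IsGenerator Q p.1 p.2}.ncard : ℝ) - 3 / Real.pi ^ 2 * (Q : ℝ) ^ 2| ≤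
      2 * (Q * (3 + Real.log (1 + 2 * Q))) := by
  have hQ' : (1 : ℤ) ≤ Q := by exact_mod_cast hQ
  have h := abs_ncard_coprimePoints_sub_le_of_subset hQ convex_fareyTriangle
    measurableSet_fareyTriangle subset_rfl one_ne_zero (c := (1, 1)) isCoprime_one_left
  have h1 : coprimePoints Q 1 (1, 1) fareyTriangle = {p : ℤ × ℤ | IsGenerator Q p.1 p.2} := by
    ext p
    simp only [coprimePoints, mem_ofPred_eq, isGenerator_iff hQ', Nat.cast_one, Int.modEq_one,
      true_and]
  have h2 : coprimeDensity 1 * ((Q : ℝ) ^ 2 * area fareyTriangle) =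
      3 / Real.pi ^ 2 * (Q : ℝ) ^ 2 := by
    rw [area_fareyTriangle, coprimeDensity]
    simp
    ring
  rwa [h1, h2] at h

theorem coprimeDensity_mul_tsum (r : ℕ) (c : Fin r → ℕ) (d : ℕ) :
    coprimeDensity d * ∑' k : admissibleOfParity r c d, area (polygon (k : Fin (r - 2) → ℕ)) =
      3 / Real.pi ^ 2 * mainTerm r c d := by
  rw [coprimeDensity, mainTerm]
  ring

theorem mainTerm_mem_Icc (r : ℕ) (c : Fin r → ℕ) {d : ℕ} (hd : d ≠ 0) :
    mainTerm r c d ∈ Icc 0 1 := by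
  have h1 := prod_inv_le hd
  have h2 := tsum_area_le (admissibleOfParity r c d)
  have h3 : 0 ≤ ∑' k : admissibleOfParity r c d, area (polygon (k : Fin (r - 2) → ℕ)) :=
    tsum_nonneg fun _ => area_nonneg _
  have h4 := coprimeDensity_nonneg d
  have h5 : 0 < 6 / Real.pi ^ 2 := by positivity
  rw [coprimeDensity, mul_div_assoc, mul_nonneg_iff_of_pos_left h5] at h4
  have h6 : mainTerm r c d = (∏ p ∈ d.primeFactors, (1 - 1 / (p : ℝ) ^ 2)⁻¹) / (d : ℝ) ^ 2 *
      (2 * ∑' k : admissibleOfParity r c d, area (polygon (k : Fin (r - 2) → ℕ))) := by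
    rw [mainTerm]; ring
  rw [h6]
  exact ⟨by positivity, mul_le_one₀ h1 (by positivity) (by linarith)⟩

/-- The threshold absorbs the number `(4 * s + 13) ^ s` of small vectors into one logarithm; this is
why `Q₀` depends on `r` while the constant does not. -/
theorem eventually_large (r : ℕ) : ∃ Q₀ : ℕ, ∀ Q : ℕ, Q₀ ≤ Q → 3 ≤ Q ∧ 1 ≤ Real.log Q ∧
    (4 * (r - 2 : ℕ) + 13 : ℝ) ^ (r - 2) ≤ Real.log Q ∧ Real.log Q ≤ 1 / 100 * (Q : ℝ) ∧
    (r : ℝ) ≤ 1 / 100 * (Q : ℝ) := by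
  have hcast : Filter.Tendsto (fun Q : ℕ => (Q : ℝ)) Filter.atTop Filter.atTop :=
    tendsto_natCast_atTop_atTop
  have hlog := Real.tendsto_log_atTop.comp hcast
  have h1 := (Real.isLittleO_log_id_atTop.comp_tendsto hcast).bound
    (by norm_num : (0 : ℝ) < 1 / 100)
  have h := (Filter.eventually_ge_atTop 3).and ((hlog.eventually_ge_atTop 1).and
    ((hlog.eventually_ge_atTop ((4 * (r - 2 : ℕ) + 13 : ℝ) ^ (r - 2))).and
      (h1.and (hcast.eventually_ge_atTop (100 * (r : ℝ))))))
  obtain ⟨Q₀, hQ₀⟩ := Filter.eventually_atTop.1 h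
  refine ⟨Q₀, fun Q hQ => ?_⟩
  obtain ⟨a, b, c, d, e⟩ := hQ₀ Q hQ
  refine ⟨a, b, c, ?_, by linarith⟩
  simp only [Function.comp, id, Real.norm_eq_abs, Nat.abs_cast] at d
  exact (le_abs_self _).trans d

theorem abs_rho_sub_mainTerm_le {r : ℕ} (hr : 3 ≤ r) {Q : ℕ} (hQ3 : 3 ≤ Q)
    (hlog1 : 1 ≤ Real.log Q)
    (hpow : (4 * (r - 2 : ℕ) + 13 : ℝ) ^ (r - 2) ≤ Real.log Q)
    (hlogQ : Real.log Q ≤ 1 / 100 * (Q : ℝ)) (hrQ : (r : ℝ) ≤ 1 / 100 * (Q : ℝ)) {d : ℕ}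
    (hd : d ≠ 0) (c : Fin r → ℕ) :
    |rho Q r c d - mainTerm r c d| ≤ 2000 * ((r : ℝ) * (Q : ℝ)⁻¹ * Real.log Q ^ 2) := by
  have hQ1 : 1 ≤ Q := by omega
  have hQ' : (3 : ℝ) ≤ Q := by exact_mod_cast hQ3
  have hr' : (3 : ℝ) ≤ r := by exact_mod_cast hr
  set l := Real.log Q with hl
  set L := 3 + Real.log (1 + 2 * (Q : ℝ)) with hLdef
  have hL : L ≤ 5 * l := by
    have h1 : Real.log (1 + 2 * (Q : ℝ)) ≤ Real.log ((Q : ℝ) ^ 2) :=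
      Real.log_le_log (by positivity) (by nlinarith)
    rw [Real.log_pow] at h1
    push_cast at h1
    linarith
  have hL0 : 0 ≤ L := by
    have : 0 ≤ Real.log (1 + 2 * (Q : ℝ)) := Real.log_nonneg (by linarith)
    linarith
  set G : ℝ := ({p : ℤ × ℤ | IsGenerator Q p.1 p.2}.ncard : ℝ) with hG
  set N : ℝ := ((tuplesOfParity Q r c d).ncard : ℝ) with hN
  set N' : ℝ := ((generatorsOfParity Q r c d).ncard : ℝ) with hN'
  set M := mainTerm r c d with hM
  set α := 3 / Real.pi ^ 2 with hα
  have hG1 : |G - α * (Q : ℝ) ^ 2| ≤ 2 * (Q * L) := abs_ncard_generators_sub_le hQ1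
  have hN1 := abs_ncard_generatorsOfParity_sub_le hQ1 (by omega : 2 ≤ r) c hd
  rw [mul_left_comm, coprimeDensity_mul_tsum, ← hM, ← hα, ← hN', ← hLdef] at hN1
  obtain ⟨hN2, hN3⟩ := ncard_tuplesOfParity_le (Q := Q) (by omega : 2 ≤ r) c d
  have hN2' : N ≤ N' := by rw [hN, hN']; exact_mod_cast hN2
  have hN3' : N' ≤ N + r := by rw [hN, hN']; exact_mod_cast hN3
  obtain ⟨hM0, hM1⟩ := mainTerm_mem_Icc r c hd
  rw [← hM] at hM0 hM1
  have hα1 : 3 / 10 ≤ α := by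
    rw [hα, div_le_div_iff₀ (by norm_num) (by positivity)]
    nlinarith [Real.pi_lt_d2, Real.pi_pos]
  have hrs : ((r - 2 : ℕ) : ℝ) ≤ r := by exact_mod_cast Nat.sub_le r 2
  have hQl : (Q : ℝ) * L ≤ 5 * (Q * l) :=
    (mul_le_mul_of_nonneg_left hL (Nat.cast_nonneg Q)).trans_eq (by ring)
  have hQll : (Q : ℝ) * L ^ 2 ≤ 25 * (Q * l ^ 2) := by
    have : L ^ 2 ≤ (5 * l) ^ 2 := by gcongr
    exact (mul_le_mul_of_nonneg_left this (Nat.cast_nonneg Q)).trans_eq (by ring)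
  have hll : l ≤ l ^ 2 := le_self_pow₀ hlog1 two_ne_zero
  have hX : 0 ≤ Q * l ^ 2 := by positivity
  have hbd : (4 * (r - 2 : ℕ) + 13 : ℝ) ^ (r - 2) * (2 * (Q * L)) +
      (r - 2 : ℕ) * (8 * (Q * L ^ 2)) ≤ 210 * (r * (Q * l ^ 2)) := by
    have h1 : (4 * (r - 2 : ℕ) + 13 : ℝ) ^ (r - 2) * (2 * (Q * L)) ≤ l * (2 * (5 * (Q * l))) := by
      gcongr
    have h2 : ((r - 2 : ℕ) : ℝ) * (8 * (Q * L ^ 2)) ≤ r * (8 * (25 * (Q * l ^ 2))) := by gcongr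
    have h3 : 1 * (Q * l ^ 2) ≤ r * (Q * l ^ 2) := by gcongr; linarith
    have h4 : l * (2 * (5 * (Q * l))) = 10 * (Q * l ^ 2) := by ring
    linarith
  clear_value l L
  have hD : (((fareySet Q).ncard : ℝ) - ((r : ℝ) - 1)) = G + 2 - r := by
    rw [ncard_fareySet hQ1]; push_cast; ring
  rw [rho, hD, ← hN]
  set D := G + 2 - r with hDdef
  -- The main part is at least `0.3 Q²`; the error is at most `10 Q log Q ≤ 0.1 Q²`, and `r ≤ 0.01
  -- Q`.
  have hDpos : (Q : ℝ) ^ 2 / 8 ≤ D := by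
    have h1 := (abs_le.1 hG1).1
    have h2 : (Q : ℝ) * l ≤ Q * (1 / 100 * Q) := by gcongr
    have h3 : 3 / 10 * (Q : ℝ) ^ 2 ≤ α * (Q : ℝ) ^ 2 := by gcongr
    have h4 : (Q : ℝ) ≤ (Q : ℝ) ^ 2 := le_self_pow₀ (by linarith) two_ne_zero
    have h5 : (Q : ℝ) * (1 / 100 * Q) = (Q : ℝ) ^ 2 / 100 := by ring
    rw [hDdef]
    linarith
  have hD0 : 0 < D := lt_of_lt_of_le (by positivity) hDpos
  have hnum : |N - M * D| ≤ 250 * (r * (Q * l ^ 2)) := by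
    have e1 : |N - N'| ≤ r := by rw [abs_le]; constructor <;> linarith
    have e2 : |M * (α * (Q : ℝ) ^ 2 - D)| ≤ 2 * (Q * L) + r := by
      rw [abs_mul, abs_of_nonneg hM0]
      refine (mul_le_of_le_one_left (abs_nonneg _) hM1).trans ?_
      rw [hDdef]
      rw [abs_le] at hG1 ⊢
      constructor <;> linarith [hG1.1, hG1.2]
    -- Three errors: the tuples lost at the end, the discrepancy over the polygons, and the error in
    -- the denominator weighted by the main term, which lies in `[0, 1]`. The constant `2000` is
    -- `250` from here times `8` from `hDpos`.
    have e3 : N - M * D = (N - N') + (N' - (Q : ℝ) ^ 2 * (α * M)) + M * (α * (Q : ℝ) ^ 2 - D) := by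
      ring
    have h1 : (Q : ℝ) * l ≤ Q * l ^ 2 := by gcongr
    have h2 : 1 ≤ Q * l ^ 2 := one_le_mul_of_one_le_of_one_le (by linarith) (one_le_pow₀ hlog1)
    have h3 : (r : ℝ) * 1 ≤ r * (Q * l ^ 2) := by gcongr
    have h4 : 3 * (Q * l ^ 2) ≤ r * (Q * l ^ 2) := by gcongr
    rw [e3]
    refine (abs_add_three _ _ _).trans ?_
    linarith
  have hquot : N / D - M = (N - M * D) / D := by field_simp
  rw [hquot, abs_div, abs_of_pos hD0, div_le_iff₀ hD0]
  have hQ0 : (0 : ℝ) < Q := by linarith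
  calc |N - M * D| ≤ 250 * (r * (Q * l ^ 2)) := hnum
    _ = 2000 * (r * (Q : ℝ)⁻¹ * l ^ 2) * ((Q : ℝ) ^ 2 / 8) := by field_simp; norm_num
    _ ≤ _ := by gcongr

end FareyResidues

theorem theorem2 :
    (∀ (r d : ℕ) (c : Fin r → ℕ), 3 ≤ r → 2 ≤ d → (∀ j, c j ≤ d - 1) →
      Summable fun k : FareyResidues.admissibleOfParity r c d =>
        FareyResidues.area (FareyResidues.polygon (k : Fin (r - 2) → ℕ))) ∧
    ∃ C : ℝ, 0 < C ∧ ∀ r : ℕ, 3 ≤ r → ∃ Q₀ : ℕ, ∀ Q : ℕ, Q₀ ≤ Q →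
      ∀ (d : ℕ) (c : Fin r → ℕ), 2 ≤ d → (∀ j, c j ≤ d - 1) →
        |FareyResidues.rho Q r c d - FareyResidues.mainTerm r c d| ≤
          C * ((r : ℝ) * (Q : ℝ)⁻¹ * Real.log Q ^ 2) := by
  refine ⟨fun r d c _ _ _ => FareyResidues.summable_area _, 2000, by norm_num, fun r hr => ?_⟩
  obtain ⟨Q₀, hQ₀⟩ := FareyResidues.eventually_large r
  refine ⟨Q₀, fun Q hQ d c hd _ => ?_⟩
  obtain ⟨h1, h2, h3, h4, h5⟩ := hQ₀ Q hQ
  exact FareyResidues.abs_rho_sub_mainTerm_le hr h1 h2 h3 h4 h5 (by omega) c
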